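/- **Setting.** *Neighboring datasets* are datasets of the same size $B$ that differ in at most one entry. A randomized algorithm $q$ is $(\varepsilon,\delta)$-DP if $\mathbb P(q(S)\in E)\le e^{\varepsilon}\,\mathbb P(q(S')\in E)+\delta$ for all neighboring $S,S'$ and all measurable $E$. *Stability-based histogram.* For parameters $(\varepsilon',\delta')$, points $x_1,\dots,x_n\in\mathbb R$ and countably many disjoint bins, let $\hat p_k$ be the fraction of points in bin $k$. If $\hat p_k=0$ put $\tilde p_k=0$. Otherwise put $\tilde p_k=\hat p_k+\mathrm{Lap}(2/(\varepsilon' n))$ with independent noise for each bin, and reset $\tilde p_k$ to $0$ if it is smaller than $\frac{2\log(2/\delta')}{\varepsilon' n}+\frac1n$. *Private Mean Estimation.* Inputs are $g_1,\dots,g_B\in\mathbb R^d$ and the parameters $\varepsilon,\delta,\zeta$, $K,a>0$, $\hat\Lambda>0$. Let $\tau=2^{1/4}K\sqrt{\hat\Lambda}\,\log^a 25$ and $r=3K\sqrt{\hat\Lambda}\,\log^a(Bd/\zeta)$. For each $j\in[d]$, independently, run the $\big(\frac{\varepsilon}{4\sqrt{2d\log(4/\delta)}},\frac{\delta}{4d}\big)$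 stability-based histogram on $\{g_{ij}\}_{i\in[B]}$ with the bins $(k\tau,(k+1)\tau]$, $k\in\mathbb Z$, and let $\bar g_j$ be the left end point of a bin with the largest released value (ties are broken by a fixed rule; if all released values are $0$, then $\bar g_j=0$). Let $\tilde g_{ij}$ be the projection of $g_{ij}$ to $[\bar g_j-r,\bar g_j+r]$. Return $\hat\mu=\frac1B\sum_{i=1}^B\tilde g_i+\mathcal N(0,s^2\mathbf I_d)$, where $$s=\frac{12K\sqrt{\hat\Lambda}\,\log^a(Bd/\zeta)\sqrt{2d\log(2.5/\delta)}}{\varepsilon B}.$$ *Data model.* $A_1,\dots,A_B\in\mathbb R^{d\times d}$ are i.i.d. copies of a random matrix $A$ with finite second moments. Its mean $\Sigma=\mathbb E[A]$ is symmetric positive semidefinite with largest eigenvalue $\lambda_1$. For a vector $u$ put $H_u=\lambda_1^{-2}\,\mathbb E[(A-\Sigma)uu^\top(A-\Sigma)^\top]$. With constants $K,a>0$, for all unit vectors $u,v$, $$\mathbb E\left[\exp\left(\left(\frac{|u^\top(A^\top-\Sigma)v|^2}{K^2\lambda_1^2\|H_u\|_2}\right)^{1/(2a)}\right)\right]\le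 2,$$ where $\|\cdot\|_2$ is the spectral norm and a fraction with denominator $0$ is read as $0$. **Lemma.** (i) For all $\varepsilon\in(0,0.9)$ and $\delta,\zeta\in(0,1)$, and all $d,B,K,a,\hat\Lambda$ with $K,a,\hat\Lambda>0$, Private Mean Estimation is $(\varepsilon,\delta)$-DP. (ii) For every $a>0$ there is a constant $C>0$, depending on $a$ only, such that the following holds. Let $\varepsilon\in(0,0.9)$, $\delta,\zeta\in(0,1)$, $B\ge2$, let $A_1,\dots,A_B$ follow the data model with parameters $K,a$, and let $g_i=A_iu$ for a fixed vector $u\in\mathbb R^d$. Suppose that $\hat\Lambda>0$, $$\hat\Lambda\in\left[\lambda_1^2\|H_u\|_2/\sqrt2,\ \sqrt2\,\lambda_1^2\|H_u\|_2\right],\qquad \delta\le \frac1B,\qquad B\ \ge\ C\,\frac{\sqrt{d\log(1/\delta)}}{\varepsilon}\,\log\frac{d}{\zeta\delta}.$$ Then, with probability at least $1-\zeta$ over the sample and the histogram noise, $$g_i\in\bar g+\left[-3K\sqrt{\hat\Lambda}\log^a(Bd/\zeta),\ 3K\sqrt{\hat\Lambda}\log^a(Bd/\zeta)\right]^d\quad\text{for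 all } i\in[B],$$ no truncation occurs, i.e. $\tilde g_i=g_i$ for all $i$, and the conditional law of the output $\hat\mu$ given the sample and the histogram noise is the spherical Gaussian $\mathcal N\big(\frac1B\sum_{i=1}^B g_i,\ s^2\mathbf I_d\big)$. -/

import Mathlib

open MeasureTheory ProbabilityTheory

/-! ### Differential privacy -/

/-- Two datasets of the same size are neighboring if they differ in at most one entry. -/
def Neighboring {n : ℕ} {X : Type*} (S S' : Fin n → X) : Prop :=
  ∃ i, ∀ j, j ≠ i → S j = S' j

/-- A randomized algorithm is given by its output `q S ω` as a function of the dataset `S` and of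
internal randomness `ω` with law `P`. It is `(ε, δ)`-differentially private if
`P(q(S) ∈ E) ≤ e^ε P(q(S') ∈ E) + δ` for all neighboring `S, S'` and all measurable `E`. -/
def IsDifferentiallyPrivate {n : ℕ} {X Y Ω : Type*} [MeasurableSpace Y] [MeasurableSpace Ω]
    (P : Measure Ω) (q : (Fin n → X) → Ω → Y) (ε δ : ℝ) : Prop :=
  ∀ S S' : Fin n → X, Neighboring S S' → ∀ E : Set Y, MeasurableSet E →
    P {ω | q S ω ∈ E} ≤ ENNReal.ofReal (Real.exp ε) * P {ω | q S' ω ∈ E} + ENNReal.ofReal δ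

/-! ### Laplace and Gaussian noise -/

/-- The standard Laplace distribution on `ℝ`, with density `exp (-|x|) / 2`; `b` times a standard
Laplace variable has the distribution `Lap(b)`. -/
noncomputable def stdLaplace : Measure ℝ :=
  volume.withDensity fun x => ENNReal.ofReal (Real.exp (-|x|) / 2)

instance isProbabilityMeasure_stdLaplace : IsProbabilityMeasure stdLaplace := by
  have h1 : ∫ x : ℝ, Real.exp (-|x|) / 2 = 1 := by
    have h2 : ∫ x : ℝ, Real.exp (-|x|) = 2 := by
      rw [integral_comp_abs (f := fun x => Real.exp (-x)), integral_exp_neg_Ioi_zero]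
      norm_num
    rw [integral_div, h2]
    norm_num
  have hi : Integrable (fun x : ℝ => Real.exp (-|x|) / 2) :=
    MeasureTheory.Integrable.of_integral_ne_zero (by rw [h1]; norm_num)
  constructor
  rw [stdLaplace, withDensity_apply _ MeasurableSet.univ, Measure.restrict_univ,
    ← ofReal_integral_eq_lintegral_ofReal hi (Filter.Eventually.of_forall fun x => by positivity),
    h1, ENNReal.ofReal_one]

/-- The noise used by the `d` calls of the histogram learner: independent standard Laplace
variables, one for each coordinate and each bin. -/
noncomputable def histNoise (d : ℕ) : Measure (Fin d → ℤ → ℝ) :=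
  Measure.pi fun _ : Fin d => Measure.infinitePi fun _ : ℤ => stdLaplace

/-- The standard Gaussian distribution `N(0, I_d)`. -/
noncomputable def stdGaussianNoise (d : ℕ) : Measure (Fin d → ℝ) :=
  Measure.pi fun _ : Fin d => gaussianReal 0 1

/-- The spherical Gaussian distribution `N(m, σ² I_d)`. -/
noncomputable def sphericalGaussian {d : ℕ} (m : Fin d → ℝ) (σ : ℝ) : Measure (Fin d → ℝ) :=
  Measure.pi fun j : Fin d => gaussianReal (m j) (Real.toNNReal (σ ^ 2))

/-! ### The private histogram learner -/

/-- The fraction of the points `x i` lying in the set `I`. -/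
noncomputable def binFraction {n : ℕ} (x : Fin n → ℝ) (I : Set ℝ) : ℝ :=
  (Set.ncard {i : Fin n | x i ∈ I} : ℝ) / n

open Classical in
/-- The `(ε, δ)` stability-based histogram of `x` over the disjoint bins `bins k`, with standard
Laplace noise `ξ k` in bin `k`: an empty bin is released as `0`; to the fraction of points in an
occupied bin the noise `Lap(2 / (ε n))` is added, and the result is replaced by `0` if it is
smaller than the threshold `2 log(2/δ) / (ε n) + 1/n`. -/
noncomputable def stabilityHistogram (ε δ : ℝ) {n : ℕ} (bins : ℤ → Set ℝ) (x : Fin n → ℝ)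
    (ξ : ℤ → ℝ) (k : ℤ) : ℝ :=
  if binFraction x (bins k) = 0 then 0
  else if binFraction x (bins k) + 2 / (ε * n) * ξ k <
      2 * Real.log (2 / δ) / (ε * n) + 1 / n then 0
  else binFraction x (bins k) + 2 / (ε * n) * ξ k

open Classical in
/-- An index at which the histogram `p` is maximal: the first one in the enumeration
`0, -1, 1, -2, 2, …` of the integers. If no bin is released at all, this is bin `0`. -/
noncomputable def maxBin (p : ℤ → ℝ) : ℤ :=
  if h : ∃ n : ℕ, ∀ m : ℤ, p m ≤ p (Equiv.intEquivNat.symm n) then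
    Equiv.intEquivNat.symm (Nat.find h)
  else 0

/-! ### Private Mean Estimation -/

/-- The bin width `τ = 2^{1/4} K √Λ log^a 25`. -/
noncomputable def binWidth (K a Λ : ℝ) : ℝ :=
  (2 : ℝ) ^ (1 / 4 : ℝ) * K * √Λ * Real.log 25 ^ a

/-- The half-width `3 K √Λ log^a(B d / ζ)` of the truncation box. -/
noncomputable def truncRadius (d B : ℕ) (ζ K a Λ : ℝ) : ℝ :=
  3 * K * √Λ * Real.log (B * d / ζ) ^ a

/-- The standard deviation `12 K √Λ log^a(B d / ζ) √(2 d log(2.5/δ)) / (ε B)` of the noise. -/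
noncomputable def noiseScale (d B : ℕ) (ε δ ζ K a Λ : ℝ) : ℝ :=
  12 * K * √Λ * Real.log (B * d / ζ) ^ a * √(2 * d * Real.log (2.5 / δ)) / (ε * B)

/-- The center `ḡ` of the truncation box: for each coordinate `j`, the left end point of the bin
with the largest value in the private histogram of `{g_ij}_i` over the bins `(kτ, (k+1)τ]`. -/
noncomputable def boxCenter {d B : ℕ} (ε δ K a Λ : ℝ) (g : Fin B → Fin d → ℝ)
    (ξ : Fin d → ℤ → ℝ) (j : Fin d) : ℝ :=
  (maxBin (stabilityHistogram (ε / (4 * √(2 * d * Real.log (4 / δ)))) (δ / (4 * d))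
    (fun k : ℤ => Set.Ioc (k * binWidth K a Λ) ((k + 1) * binWidth K a Λ))
    (fun i => g i j) (ξ j)) : ℝ) * binWidth K a Λ

/-- The truncated gradients: each coordinate `g_ij` is projected to the interval
`[ḡ_j - r, ḡ_j + r]`, where `r` is the truncation radius. -/
noncomputable def truncated {d B : ℕ} (ε δ ζ K a Λ : ℝ) (g : Fin B → Fin d → ℝ)
    (ξ : Fin d → ℤ → ℝ) (i : Fin B) (j : Fin d) : ℝ :=
  max (boxCenter ε δ K a Λ g ξ j - truncRadius d B ζ K a Λ)
    (min (boxCenter ε δ K a Λ g ξ j + truncRadius d B ζ K a Λ) (g i j))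

/-- The empirical mean of `B` vectors. -/
noncomputable def empiricalMean {d B : ℕ} (g : Fin B → Fin d → ℝ) (j : Fin d) : ℝ :=
  (1 / (B : ℝ)) * ∑ i, g i j

/-- Private Mean Estimation: the empirical mean of the truncated gradients plus spherical Gaussian
noise. The internal randomness consists of the histogram noise `ω.1` and of a standard Gaussian
vector `ω.2`. -/
noncomputable def privateMean {d B : ℕ} (ε δ ζ K a Λ : ℝ) (g : Fin B → Fin d → ℝ)
    (ω : (Fin d → ℤ → ℝ) × (Fin d → ℝ)) (j : Fin d) : ℝ :=
  empiricalMean (truncated ε δ ζ K a Λ g ω.1) j + noiseScale d B ε δ ζ K a Λ * ω.2 j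

/-- The law of the internal randomness of Private Mean Estimation. -/
noncomputable def privateMeanNoise (d : ℕ) : Measure ((Fin d → ℤ → ℝ) × (Fin d → ℝ)) :=
  (histNoise d).prod (stdGaussianNoise d)

/-! ### The distribution of the data -/

/-- The product σ-algebra on matrices. -/
instance matrixMeasurableSpace {m n : Type*} : MeasurableSpace (Matrix m n ℝ) :=
  inferInstanceAs (MeasurableSpace (m → n → ℝ))

/-- The spectral norm `max_{‖v‖ = 1} ‖X v‖` for the Euclidean norm. -/
noncomputable def spectralNorm₂ {d : ℕ} (X : Matrix (Fin d) (Fin d) ℝ) : ℝ :=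
  ‖Matrix.toEuclideanCLM (n := Fin d) (𝕜 := ℝ) X‖

/-- The largest eigenvalue of a symmetric matrix. -/
noncomputable def topEigenvalue {d : ℕ} (S : Matrix (Fin d) (Fin d) ℝ) : ℝ :=
  sSup (spectrum ℝ S)

/-- The matrix `H_u = λ₁⁻² E[(A - Σ) u uᵀ (A - Σ)ᵀ]`, where `A` has law `μ` and `λ₁` is the top
eigenvalue of `S = Σ`. -/
noncomputable def Hmat {d : ℕ} (μ : Measure (Matrix (Fin d) (Fin d) ℝ))
    (S : Matrix (Fin d) (Fin d) ℝ) (u : Fin d → ℝ) : Matrix (Fin d) (Fin d) ℝ :=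
  (1 / topEigenvalue S ^ 2) •
    Matrix.of fun i j => ∫ A, ((A - S) * Matrix.vecMulVec u u * (A - S).transpose) i j ∂μ

/-- The law `μ` of the random matrix `A` satisfies the mean assumption and the tail assumption
with parameters `Σ = S`, `K`, `a`. -/
structure GradientModel {d : ℕ} (μ : Measure (Matrix (Fin d) (Fin d) ℝ))
    (S : Matrix (Fin d) (Fin d) ℝ) (K a : ℝ) : Prop where
  K_pos : 0 < K
  a_pos : 0 < a
  isProb : IsProbabilityMeasure μ
  /-- The second moments, and hence `Σ` and the matrices `H_u`, are finite. -/
  memLp : ∀ i j, MemLp (fun A : Matrix (Fin d) (Fin d) ℝ => A i j) 2 μ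
  posSemidef : S.PosSemidef
  mean : ∀ i j, ∫ A : Matrix (Fin d) (Fin d) ℝ, A i j ∂μ = S i j
  /-- Gaussian-like tail: for all unit vectors `u`, `v`,
  `E exp ((|uᵀ (Aᵀ - Σ) v|² / (K² λ₁² ‖H_u‖₂)) ^ (1/(2a))) ≤ 2`. -/
  tail : ∀ u v : Fin d → ℝ, dotProduct u u = 1 → dotProduct v v = 1 →
    ∫⁻ A : Matrix (Fin d) (Fin d) ℝ, ENNReal.ofReal (Real.exp
      ((|dotProduct u ((A.transpose - S).mulVec v)| ^ 2 /
        (K ^ 2 * topEigenvalue S ^ 2 * spectralNorm₂ (Hmat μ S u))) ^ (1 / (2 * a)))) ∂μ ≤ 2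

/-! Privacy. Runs on neighboring `g`, `g'` are compared by translating the histogram noise. In one
coordinate, changing one point moves at most two bin fractions, each by at most 1/B, so a noise
shift of total size at most ε₀ = ε / (4√(2d log(4/δ))) makes the two histograms agree on every bin
occupied in both datasets. A bin occupied in only one of them contains just the changed point, and
the threshold suppresses it unless one Laplace variable reaches log(8d/δ). `maskedHistogram` deletes
such bins outright, which costs probability δ/16 for each dataset. After the shift both runs use the
same box, so the clipped means differ by at most 2r/B in each coordinate, and the Gaussian noise
hides this difference.

Both changes of measure are recorded through `HolderDominated`, a Rényi divergence bound in dual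
form. It multiplies over coordinates (`HolderDominated.pi`), so that the pure cost ε₀ accumulates
like d ε₀² instead of d ε₀ (`HolderDominated.of_pure`), and it composes with a Gaussian release
whose center depends on the histogram (`adaptive_release_le`). Young's inequality
(`le_mul_add_of_le_mul_rpow`) at order α = 1 + 2 log(2.5/δ)/ε converts the total into an (ε, δ/2)
bound; `renyi_budget` checks the arithmetic.

Utility. Markov's inequality for the exponential moment gives P(|g_ij - (Σu)_j| ≥ K√V log^a x) ≤ 2/x
with V = λ₁²‖H_u‖₂ (`GradientModel.tail_le`). At x = 25 this deviation is at most the bin width τ,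
so by Chernoff at most a fifth of the points are outliers at scale τ. The others lie in three
consecutive bins, one of which has fraction at least 4/15. With small noise the winning bin then has
fraction above 1/5, so it contains an inlier, and its left end point is within 2τ of the mean
(`abs_maxBin_sub_le`). At x = 8Bd/ζ all points lie close enough to the mean to fit in the box once
log(Bd/ζ) is large in terms of a (`box_radius_le`). If nothing is clipped, the output is an affine
image of the Gaussian noise. -/

open scoped ENNReal

/-! ### Hölder domination as a calculus of Rényi bounds -/

/-- `Q` is dominated by `P` in the sense of Hölder's inequality with exponent `β` and constant `N`.
When `β` is conjugate to `α`, this is a bound on the Rényi divergence of order `α`. -/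
def HolderDominated {X : Type*} [MeasurableSpace X] (β : ℝ) (N : ℝ≥0∞) (Q P : Measure X) : Prop :=
  ∀ f : X → ℝ≥0∞, Measurable f → ∫⁻ x, f x ∂Q ≤ N * (∫⁻ x, f x ^ β ∂P) ^ (1 / β)

/-- Hölder's inequality for the product of f and the density. The constant is the L^α norm of the
density, the exponential of (α-1)/α times the Rényi divergence. -/
theorem HolderDominated.of_withDensity {X : Type*} [MeasurableSpace X] {P : Measure X}
    {ρ : X → ℝ≥0∞} (hρ : Measurable ρ) {α β : ℝ} (h : α.HolderConjugate β) :
    HolderDominated β ((∫⁻ x, ρ x ^ α ∂P) ^ (1 / α)) (P.withDensity ρ) P := by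
  intro f hf
  rw [lintegral_withDensity_eq_lintegral_mul _ hρ hf]
  exact ENNReal.lintegral_mul_le_Lp_mul_Lq P h hρ.aemeasurable hf.aemeasurable

theorem HolderDominated.mono {X : Type*} [MeasurableSpace X] {P Q : Measure X} {β : ℝ}
    {N N' : ℝ≥0∞} (h : HolderDominated β N Q P) (hN : N ≤ N') : HolderDominated β N' Q P :=
  fun f hf => (h f hf).trans (by gcongr)

/-- Coordinates are integrated one at a time. The inductive bound carries a power 1/β; the
hypothesis for the next coordinate raises it to the power β again, so the exponents cancel and only
the constants multiply. -/
theorem HolderDominated.lmarginal {ι : Type*} [DecidableEq ι] {X : ι → Type*}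
    [∀ i, MeasurableSpace (X i)] {P Q : ∀ i, Measure (X i)} [∀ i, SigmaFinite (P i)]
    [∀ i, SigmaFinite (Q i)] {β : ℝ} (hβ : 0 < β) {N : ι → ℝ≥0∞}
    (h : ∀ i, HolderDominated β (N i) (Q i) (P i)) (s : Finset ι) (f : (∀ i, X i) → ℝ≥0∞)
    (hf : Measurable f) (x : ∀ i, X i) :
    MeasureTheory.lmarginal Q s f x ≤
      (∏ i ∈ s, N i) * (MeasureTheory.lmarginal P s (fun y => f y ^ β) x) ^ (1 / β) := by
  induction s using Finset.induction_on generalizing x with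
  | empty =>
    simp only [lmarginal_empty, Finset.prod_empty, one_mul]
    rw [← ENNReal.rpow_mul, mul_one_div_cancel hβ.ne', ENNReal.rpow_one]
  | insert i s hi ih =>
    have hfβ : Measurable fun y => f y ^ β := hf.pow_const β
    rw [lmarginal_insert f hf hi, lmarginal_insert _ hfβ hi, Finset.prod_insert hi]
    have hm : Measurable fun y : X i =>
        MeasureTheory.lmarginal P s (fun y => f y ^ β) (Function.update x i y) :=
      (hfβ.lmarginal P).comp (measurable_update x)
    calc ∫⁻ y, MeasureTheory.lmarginal Q s f (Function.update x i y) ∂Q i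
        ≤ ∫⁻ y, (∏ i ∈ s, N i) *
          (MeasureTheory.lmarginal P s (fun y => f y ^ β) (Function.update x i y)) ^ (1 / β) ∂Q i :=
          lintegral_mono fun y => ih _
      _ = (∏ i ∈ s, N i) * ∫⁻ y,
          (MeasureTheory.lmarginal P s (fun y => f y ^ β) (Function.update x i y)) ^ (1 / β) ∂Q i :=
          lintegral_const_mul _ (hm.pow_const _)
      _ ≤ (∏ i ∈ s, N i) * (N i * (∫⁻ y,
          ((MeasureTheory.lmarginal P s (fun y => f y ^ β)
            (Function.update x i y)) ^ (1 / β)) ^ β ∂P i) ^ (1 / β)) := by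
          gcongr
          exact h i _ (hm.pow_const _)
      _ = _ := by
          simp_rw [← ENNReal.rpow_mul, one_div_mul_cancel hβ.ne', ENNReal.rpow_one]
          ring

theorem HolderDominated.pi {ι : Type*} [Fintype ι] {X : ι → Type*}
    [∀ i, MeasurableSpace (X i)] {P Q : ∀ i, Measure (X i)} [∀ i, IsProbabilityMeasure (P i)]
    [∀ i, IsProbabilityMeasure (Q i)] {β : ℝ} (hβ : 0 < β) {N : ι → ℝ≥0∞}
    (h : ∀ i, HolderDominated β (N i) (Q i) (P i)) :
    HolderDominated β (∏ i, N i) (Measure.pi Q) (Measure.pi P) := by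
  classical
  intro f hf
  have x : ∀ i, X i := fun i => ((P i).nonempty_of_neZero).some
  rw [lintegral_eq_lmarginal_univ x, lintegral_eq_lmarginal_univ x]
  exact HolderDominated.lmarginal hβ h Finset.univ f hf x

/-- The chord of `x ↦ x ^ α` over `[e^{-ε}, e^ε]` lies above the graph. -/
theorem rpow_mul_sinh_le_chord {α ε x : ℝ} (hα : 1 ≤ α) (hl : Real.exp (-ε) ≤ x)
    (hu : x ≤ Real.exp ε) :
    x ^ α * (Real.exp ε - Real.exp (-ε)) ≤
      (Real.exp ε - x) * Real.exp (-(α * ε)) + (x - Real.exp (-ε)) * Real.exp (α * ε) := by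
  rcases hl.eq_or_lt with rfl | hl'
  · rw [← Real.exp_mul, show -ε * α = -(α * ε) by ring]
    linarith
  rcases hu.eq_or_lt with rfl | hu'
  · rw [← Real.exp_mul, show ε * α = α * ε by ring]
    linarith
  have hD : 0 < Real.exp ε - Real.exp (-ε) := by linarith
  have hc := (convexOn_rpow hα).2 (Real.exp_pos (-ε)).le (Real.exp_pos ε).le
    (div_nonneg (sub_nonneg.2 hu) hD.le) (div_nonneg (sub_nonneg.2 hl) hD.le)
    (by field_simp; ring)
  have hx : ((Real.exp ε - x) / (Real.exp ε - Real.exp (-ε))) • Real.exp (-ε) +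
      ((x - Real.exp (-ε)) / (Real.exp ε - Real.exp (-ε))) • Real.exp ε = x := by
    simp only [smul_eq_mul]
    field_simp
    ring
  rw [hx] at hc
  simp only [smul_eq_mul, ← Real.exp_mul] at hc
  rw [show -ε * α = -(α * ε) by ring, show ε * α = α * ε by ring] at hc
  calc _ ≤ _ := mul_le_mul_of_nonneg_right hc hD.le
    _ = _ := by field_simp

/-- The left side is the chord of x^α evaluated at the mean 1 of a density, times the length of the
interval. It factors so that the chord value is cosh((α-1/2)ε)/cosh(ε/2); dropping the denominator
and using cosh t ≤ exp(t²/2) finishes. -/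
theorem chord_mean_le {α ε : ℝ} (hε : 0 < ε) :
    (Real.exp ε - 1) * Real.exp (-(α * ε)) + (1 - Real.exp (-ε)) * Real.exp (α * ε) ≤
      Real.exp ((α - 1 / 2) ^ 2 * ε ^ 2 / 2) * (Real.exp ε - Real.exp (-ε)) := by
  have h1 := Real.cosh_le_exp_half_sq ((α - 1 / 2) * ε)
  have e1 : Real.exp ε = Real.exp (ε / 2) ^ 2 := by rw [← Real.exp_nat_mul]; congr 1; push_cast; ring
  have e2 : Real.exp (-ε) = Real.exp (-(ε / 2)) ^ 2 := by
    rw [← Real.exp_nat_mul]; congr 1; push_cast; ring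
  have e3 : Real.exp (ε / 2) * Real.exp (-(ε / 2)) = 1 := by rw [← Real.exp_add]; simp
  have e4 : Real.exp (α * ε) = Real.exp ((α - 1 / 2) * ε) * Real.exp (ε / 2) := by
    rw [← Real.exp_add]; congr 1; ring
  have e5 : Real.exp (-(α * ε)) = Real.exp (-((α - 1 / 2) * ε)) * Real.exp (-(ε / 2)) := by
    rw [← Real.exp_add]; congr 1; ring
  have hlt : Real.exp (-(ε / 2)) ≤ Real.exp (ε / 2) := Real.exp_le_exp.2 (by linarith)
  have h2 : 2 ≤ Real.exp (ε / 2) + Real.exp (-(ε / 2)) := by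
    nlinarith [sq_nonneg (Real.exp (ε / 2) - Real.exp (-(ε / 2))), Real.exp_pos (ε / 2),
      Real.exp_pos (-(ε / 2))]
  rw [Real.cosh_eq] at h1
  rw [show ((α - 1 / 2) * ε) ^ 2 / 2 = (α - 1 / 2) ^ 2 * ε ^ 2 / 2 by ring] at h1
  have hE := Real.exp_pos ((α - 1 / 2) ^ 2 * ε ^ 2 / 2)
  set E := Real.exp ((α - 1 / 2) ^ 2 * ε ^ 2 / 2)
  rw [e4, e5, e1, e2]
  set p := Real.exp (ε / 2)
  set q := Real.exp (-(ε / 2))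
  set u := Real.exp ((α - 1 / 2) * ε)
  set w := Real.exp (-((α - 1 / 2) * ε))
  calc (p ^ 2 - 1) * (w * q) + (1 - q ^ 2) * (u * p)
      = (p * (p * q) - q) * w + (p - q * (p * q)) * u := by ring
    _ = (u + w) * (p - q) := by rw [e3]; ring
    _ ≤ (2 * E) * (p - q) := by gcongr; linarith
    _ ≤ (E * (p + q)) * (p - q) := by
      refine mul_le_mul_of_nonneg_right ?_ (by linarith)
      nlinarith
    _ = _ := by ring

/-- Pure differential privacy implies concentrated differential privacy. -/
theorem HolderDominated.of_pure {X : Type*} [MeasurableSpace X] {P Q : Measure X}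
    [IsProbabilityMeasure P] [IsProbabilityMeasure Q] {ε α β : ℝ} (hε : 0 < ε)
    (h : α.HolderConjugate β) (hQP : Q ≤ ENNReal.ofReal (Real.exp ε) • P)
    (hPQ : P ≤ ENNReal.ofReal (Real.exp ε) • Q) :
    HolderDominated β (ENNReal.ofReal (Real.exp ((α - 1 / 2) ^ 2 * ε ^ 2 / (2 * α)))) Q P := by
  have hα : 1 < α := h.lt
  have hac : Q ≪ P := (Measure.absolutelyContinuous_of_le hQP).trans
    (Measure.smul_absolutelyContinuous)
  set ρ := Q.rnDeriv P with hρ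
  have hρm : Measurable ρ := Measure.measurable_rnDeriv Q P
  have hQ : P.withDensity ρ = Q := Measure.withDensity_rnDeriv_eq Q P hac
  have hu : ∀ᵐ x ∂P, ρ x ≤ ENNReal.ofReal (Real.exp ε) := by
    refine ae_le_of_forall_setLIntegral_le_of_sigmaFinite (g := fun _ => ENNReal.ofReal _) hρm ?_
    intro s hs _
    rw [← withDensity_apply _ hs, hQ, setLIntegral_const]
    exact hQP s
  have hl : ∀ᵐ x ∂P, ENNReal.ofReal (Real.exp (-ε)) ≤ ρ x := by
    refine ae_le_of_forall_setLIntegral_le_of_sigmaFinite (f := fun _ => ENNReal.ofReal _)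
      measurable_const ?_
    intro s hs _
    rw [← withDensity_apply ρ hs, hQ, setLIntegral_const]
    calc _ ≤ ENNReal.ofReal (Real.exp (-ε)) * (ENNReal.ofReal (Real.exp ε) * Q s) := by
          gcongr
          exact hPQ s
      _ = Q s := by
          rw [← mul_assoc, ← ENNReal.ofReal_mul (Real.exp_pos _).le, ← Real.exp_add]
          simp
  have hint : ∫⁻ x, ρ x ∂P = 1 := by
    rw [← setLIntegral_univ, ← withDensity_apply _ MeasurableSet.univ, hQ, measure_univ]
  have hD : 0 < Real.exp ε - Real.exp (-ε) := by
    have := Real.exp_lt_exp.2 (show -ε < ε by linarith)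
    linarith
  set D := Real.exp ε - Real.exp (-ε) with hDdef
  -- The chord is x ↦ c x - b. With b ≥ 0 moved to the other side, the pointwise bound needs no
  -- subtraction in `ℝ≥0∞`; integrating it uses only that ρ has integral 1.
  set c := (Real.exp (α * ε) - Real.exp (-(α * ε))) / D with hc
  set b := (Real.exp (-ε) * Real.exp (α * ε) - Real.exp ε * Real.exp (-(α * ε))) / D with hb
  have hc0 : 0 ≤ c := div_nonneg (sub_nonneg.2 (Real.exp_le_exp.2 (by nlinarith))) hD.le
  have hb0 : 0 ≤ b := by
    refine div_nonneg (sub_nonneg.2 ?_) hD.le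
    rw [← Real.exp_add, ← Real.exp_add]
    exact Real.exp_le_exp.2 (by nlinarith)
  have hpt : ∀ᵐ x ∂P, ρ x ^ α + ENNReal.ofReal b ≤ ENNReal.ofReal c * ρ x := by
    filter_upwards [hu, hl] with x hx1 hx2
    have hfin : ρ x ≠ ∞ := ne_top_of_le_ne_top ENNReal.ofReal_ne_top hx1
    obtain ⟨y, hy⟩ : ∃ y, y = (ρ x).toReal := ⟨_, rfl⟩
    have hy' : ρ x = ENNReal.ofReal y := by rw [hy, ENNReal.ofReal_toReal hfin]
    rw [hy'] at hx1 hx2 ⊢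
    have h1 : y ≤ Real.exp ε := (ENNReal.ofReal_le_ofReal_iff (Real.exp_pos _).le).1 hx1
    have hy0 : 0 ≤ y := hy ▸ ENNReal.toReal_nonneg
    have h2 : Real.exp (-ε) ≤ y := (ENNReal.ofReal_le_ofReal_iff hy0).1 hx2
    rw [ENNReal.ofReal_rpow_of_nonneg hy0 (by linarith), ← ENNReal.ofReal_mul hc0,
      ← ENNReal.ofReal_add (Real.rpow_nonneg hy0 _) hb0]
    refine ENNReal.ofReal_le_ofReal ?_
    have := rpow_mul_sinh_le_chord hα.le h2 h1
    rw [← mul_le_mul_iff_left₀ hD, add_mul, hb, hc, div_mul_cancel₀ _ hD.ne',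
      div_mul_eq_mul_div, div_mul_cancel₀ _ hD.ne']
    linarith
  have hle : ∫⁻ x, ρ x ^ α ∂P ≤ ENNReal.ofReal (c - b) := by
    have h1 := lintegral_mono_ae hpt
    rw [lintegral_add_right _ measurable_const, lintegral_const_mul _ hρm, hint, lintegral_const,
      measure_univ, mul_one, mul_one] at h1
    rw [ENNReal.ofReal_sub _ hb0]
    exact ENNReal.le_sub_of_add_le_right ENNReal.ofReal_ne_top h1
  have hcb : c - b ≤ Real.exp ((α - 1 / 2) ^ 2 * ε ^ 2 / 2) := by
    rw [hc, hb, ← sub_div, div_le_iff₀ hD]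
    have := chord_mean_le (α := α) hε
    linarith
  rw [← hQ]
  refine (HolderDominated.of_withDensity hρm h).mono ?_
  calc _ ≤ (ENNReal.ofReal (Real.exp ((α - 1 / 2) ^ 2 * ε ^ 2 / 2))) ^ (1 / α) := by
        gcongr
        exact hle.trans (ENNReal.ofReal_le_ofReal hcb)
    _ = _ := by
        rw [ENNReal.ofReal_rpow_of_pos (Real.exp_pos _), ← Real.exp_mul]
        congr 2
        field_simp

/-- The density of the shifted Gaussian is exp(wx - w²/2), and its α-th moment is read off from the
Gaussian moment generating function. -/
theorem holderDominated_gaussianReal {α β : ℝ} (h : α.HolderConjugate β) (w : ℝ) :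
    HolderDominated β (ENNReal.ofReal (Real.exp ((α - 1) * w ^ 2 / 2)))
      (gaussianReal w 1) (gaussianReal 0 1) := by
  have hα : 1 < α := h.lt
  have hm : Measurable fun x : ℝ => ENNReal.ofReal (Real.exp (w * x - w ^ 2 / 2)) := by fun_prop
  have hd : gaussianReal w 1 = (gaussianReal 0 1).withDensity
      fun x => ENNReal.ofReal (Real.exp (w * x - w ^ 2 / 2)) := by
    rw [gaussianReal_of_var_ne_zero _ one_ne_zero, gaussianReal_of_var_ne_zero _ one_ne_zero,
      ← withDensity_mul _ (measurable_gaussianPDF 0 1) hm]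
    congr 1
    ext x
    simp only [Pi.mul_apply, gaussianPDF]
    rw [← ENNReal.ofReal_mul (gaussianPDFReal_nonneg _ _ _), gaussianPDFReal, gaussianPDFReal,
      mul_assoc (√_)⁻¹, ← Real.exp_add]
    congr 3
    push_cast
    ring
  rw [hd]
  refine (HolderDominated.of_withDensity hm h).mono (le_of_eq ?_)
  have h1 : ∫⁻ x, ENNReal.ofReal (Real.exp (w * x - w ^ 2 / 2)) ^ α ∂(gaussianReal 0 1) =
      ENNReal.ofReal (Real.exp (α * (α - 1) * w ^ 2 / 2)) := by
    have h2 : ∀ x : ℝ, ENNReal.ofReal (Real.exp (w * x - w ^ 2 / 2)) ^ α =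
        ENNReal.ofReal (Real.exp (-(α * w ^ 2 / 2)) * Real.exp (α * w * x)) := by
      intro x
      rw [ENNReal.ofReal_rpow_of_pos (Real.exp_pos _), ← Real.exp_mul, ← Real.exp_add]
      congr 2
      ring
    simp_rw [h2]
    rw [← ofReal_integral_eq_lintegral_ofReal ((integrable_exp_mul_gaussianReal _).const_mul _)
      (Filter.Eventually.of_forall fun x => by positivity), integral_const_mul]
    have h3 := congrFun (mgf_id_gaussianReal (μ := 0) (v := 1)) (α * w)
    simp only [mgf, id] at h3
    rw [h3, ← Real.exp_add]
    congr 2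
    push_cast
    ring
  rw [h1, ENNReal.ofReal_rpow_of_pos (Real.exp_pos _), ← Real.exp_mul]
  congr 2
  field_simp

/-- From a Hölder bound to an approximate differential privacy bound. -/
theorem le_mul_add_of_le_mul_rpow {α β t ε : ℝ} (h : α.HolderConjugate β) {p q : ℝ≥0∞}
    (hpq : p ≤ ENNReal.ofReal (Real.exp t) * q ^ (1 / β)) :
    p ≤ ENNReal.ofReal (Real.exp ε) * q + ENNReal.ofReal (Real.exp (α * t - (α - 1) * ε)) := by
  have hα : 1 < α := h.lt
  have hβ : 1 < β := h.symm.lt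
  have hαβ : 1 / β = 1 - 1 / α := by
    have := h.inv_add_inv_eq_one
    simp only [one_div]; linarith
  -- The factor e^{ε/β} is moved from the constant onto q, so that Young's inequality produces
  -- exactly e^ε q in one term; the divisions by α, β > 1 are discarded at the end.
  have hy := ENNReal.young_inequality (ENNReal.ofReal (Real.exp (t - ε * (1 / β))))
    ((ENNReal.ofReal (Real.exp ε) * q) ^ (1 / β)) h
  have e1 : ENNReal.ofReal (Real.exp t) * q ^ (1 / β) =
      ENNReal.ofReal (Real.exp (t - ε * (1 / β))) *
        (ENNReal.ofReal (Real.exp ε) * q) ^ (1 / β) := by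
    rw [ENNReal.mul_rpow_of_nonneg _ _ (by positivity),
      ENNReal.ofReal_rpow_of_pos (Real.exp_pos _), ← Real.exp_mul, ← mul_assoc,
      ← ENNReal.ofReal_mul (Real.exp_pos _).le, ← Real.exp_add]
    congr 3
    ring
  rw [e1] at hpq
  refine (hpq.trans hy).trans ?_
  rw [← ENNReal.rpow_mul, one_div_mul_cancel (by linarith), ENNReal.rpow_one,
    ENNReal.ofReal_rpow_of_pos (Real.exp_pos _), ← Real.exp_mul, add_comm]
  have e2 : (t - ε * (1 / β)) * α = α * t - (α - 1) * ε := by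
    rw [hαβ]; field_simp
  rw [e2]
  have hdiv : ∀ (x : ℝ≥0∞) (y : ℝ), 1 < y → x / ENNReal.ofReal y ≤ x := by
    intro x y hy
    refine ENNReal.div_le_of_le_mul ?_
    calc x = x * 1 := (mul_one x).symm
      _ ≤ _ := by gcongr; simpa using hy.le
  exact add_le_add (hdiv _ _ hβ) (hdiv _ _ hα)

/-! ### Laplace noise -/

/-- The ratio of the densities at x is exp(|x| - |x - s|), which the triangle inequality bounds by
exp |s|. -/
theorem stdLaplace_map_add_le (s : ℝ) :
    stdLaplace.map (fun x => x + s) ≤ ENNReal.ofReal (Real.exp |s|) • stdLaplace := by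
  refine Measure.le_iff.2 fun E hE => ?_
  have hm : Measurable fun x : ℝ => ENNReal.ofReal (Real.exp (-|x|) / 2) := by fun_prop
  have hE' : MeasurableSet ((fun x => x + s) ⁻¹' E) := hE.preimage (by fun_prop)
  rw [Measure.map_apply (by fun_prop) hE, Measure.smul_apply, smul_eq_mul, stdLaplace,
    withDensity_apply _ hE', withDensity_apply _ hE, ← lintegral_indicator hE',
    ← lintegral_indicator hE, ← lintegral_const_mul _ (hm.indicator hE),
    ← lintegral_sub_right_eq_self _ s]
  refine lintegral_mono fun x => ?_
  by_cases hx : x ∈ E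
  · have hx' : x - s ∈ (fun x => x + s) ⁻¹' E := by simpa using hx
    rw [Set.indicator_of_mem hx, Set.indicator_of_mem hx', ← ENNReal.ofReal_mul (by positivity)]
    refine ENNReal.ofReal_le_ofReal ?_
    rw [← mul_div_assoc, ← Real.exp_add]
    gcongr
    have := abs_sub_abs_le_abs_sub x (x - s)
    rw [sub_sub_cancel] at this
    linarith
  · have hx' : x - s ∉ (fun x => x + s) ⁻¹' E := by simpa using hx
    rw [Set.indicator_of_notMem hx']
    exact zero_le

theorem stdLaplace_Ici_le (t : ℝ) :
    stdLaplace {x | t ≤ x} ≤ ENNReal.ofReal (Real.exp (-t) / 2) := by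
  have hE : MeasurableSet {x : ℝ | t ≤ x} := measurableSet_Ici
  have hi : IntegrableOn (fun x : ℝ => Real.exp (-x) / 2) (Set.Ici t) :=
    ((integrableOn_Ici_iff_integrableOn_Ioi (by simp)).2 (integrableOn_exp_neg_Ioi t)).div_const 2
  rw [stdLaplace, withDensity_apply _ hE]
  calc ∫⁻ x in Set.Ici t, ENNReal.ofReal (Real.exp (-|x|) / 2)
      ≤ ∫⁻ x in Set.Ici t, ENNReal.ofReal (Real.exp (-x) / 2) := by
        refine lintegral_mono fun x => ENNReal.ofReal_le_ofReal ?_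
        gcongr
        exact le_abs_self x
    _ = ENNReal.ofReal (Real.exp (-t) / 2) := by
        rw [← ofReal_integral_eq_lintegral_ofReal hi
          (Filter.Eventually.of_forall fun x => by positivity), integral_Ici_eq_integral_Ioi,
          integral_div, integral_exp_neg_Ioi]

theorem stdLaplace_Iic_le (t : ℝ) :
    stdLaplace {x | x ≤ t} ≤ ENNReal.ofReal (Real.exp t / 2) := by
  have hE : MeasurableSet {x : ℝ | x ≤ t} := measurableSet_Iic
  have hi : IntegrableOn (fun x : ℝ => Real.exp x / 2) (Set.Iic t) :=
    (integrableOn_exp_Iic t).div_const 2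
  rw [stdLaplace, withDensity_apply _ hE]
  calc ∫⁻ x in Set.Iic t, ENNReal.ofReal (Real.exp (-|x|) / 2)
      ≤ ∫⁻ x in Set.Iic t, ENNReal.ofReal (Real.exp x / 2) := by
        refine lintegral_mono fun x => ENNReal.ofReal_le_ofReal ?_
        gcongr
        linarith [neg_abs_le x]
    _ = ENNReal.ofReal (Real.exp t / 2) := by
        rw [← ofReal_integral_eq_lintegral_ofReal hi
          (Filter.Eventually.of_forall fun x => by positivity),
          integral_div, integral_exp_Iic]

theorem stdLaplace_abs_ge_le (t : ℝ) :
    stdLaplace {x | t ≤ |x|} ≤ ENNReal.ofReal (Real.exp (-t)) := by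
  have hsub : {x : ℝ | t ≤ |x|} ⊆ {x | t ≤ x} ∪ {x | x ≤ -t} := by
    intro x hx
    rcases le_abs.1 (show t ≤ |x| from hx) with h | h
    · exact Or.inl h
    · exact Or.inr (show x ≤ -t by linarith)
  calc _ ≤ _ := measure_mono hsub
    _ ≤ _ := measure_union_le _ _
    _ ≤ _ := add_le_add (stdLaplace_Ici_le t) (stdLaplace_Iic_le (-t))
    _ = _ := by
      rw [← ENNReal.ofReal_add (by positivity) (by positivity)]
      congr 1
      ring

/-! ### Shifts of infinite products -/

/-- Changing one marginal of an infinite product amounts to resampling that coordinate. -/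
theorem infinitePi_eq_map_update {ι : Type*} [DecidableEq ι] {X : ι → Type*}
    [∀ i, MeasurableSpace (X i)] (P Q : ∀ i, Measure (X i)) [∀ i, IsProbabilityMeasure (P i)]
    [∀ i, IsProbabilityMeasure (Q i)] (k : ι) (h : ∀ i, i ≠ k → Q i = P i) :
    Measure.infinitePi Q =
      ((Q k).prod (Measure.infinitePi P)).map (fun p => Function.update p.2 k p.1) := by
  have hm : Measurable fun p : X k × (∀ i, X i) => Function.update p.2 k p.1 := by
    refine measurable_pi_lambda _ fun i => ?_
    by_cases hi : i = k
    · subst hi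
      simpa using measurable_fst
    · simp only [Function.update_of_ne hi]
      exact (measurable_pi_apply i).comp measurable_snd
  refine (Measure.eq_infinitePi Q fun s t ht => ?_).symm
  rw [Measure.map_apply hm (MeasurableSet.pi s.countable_toSet fun i _ => ht i)]
  by_cases hk : k ∈ s
  · have : (fun p : X k × (∀ i, X i) => Function.update p.2 k p.1) ⁻¹' ((s : Set ι).pi t) =
        t k ×ˢ (((s.erase k : Finset ι) : Set ι).pi t) := by
      ext p
      simp only [Set.mem_preimage, Set.mem_pi, Finset.mem_coe, Set.mem_prod, Finset.mem_erase]
      constructor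
      · intro hp
        refine ⟨by simpa using hp k hk, fun i hi => ?_⟩
        simpa [Function.update_of_ne hi.1] using hp i hi.2
      · rintro ⟨hp, hq⟩ i hi
        by_cases hik : i = k
        · subst hik
          simpa using hp
        · simpa [Function.update_of_ne hik] using hq i ⟨hik, hi⟩
    rw [this, Measure.prod_prod, Measure.infinitePi_pi P fun i _ => ht i,
      ← Finset.mul_prod_erase s _ hk]
    congr 1
    refine Finset.prod_congr rfl fun i hi => ?_
    rw [h i (Finset.ne_of_mem_erase hi)]
  · have : (fun p : X k × (∀ i, X i) => Function.update p.2 k p.1) ⁻¹' ((s : Set ι).pi t) =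
        Set.univ ×ˢ ((s : Set ι).pi t) := by
      ext p
      simp only [Set.mem_preimage, Set.mem_pi, Finset.mem_coe, Set.mem_prod, Set.mem_univ,
        true_and]
      refine forall₂_congr fun i hi => ?_
      rw [Function.update_of_ne (ne_of_mem_of_not_mem hi hk)]
    rw [this, Measure.prod_prod, measure_univ, one_mul, Measure.infinitePi_pi P fun i _ => ht i]
    refine Finset.prod_congr rfl fun i hi => ?_
    rw [h i (ne_of_mem_of_not_mem hi hk)]

/-- Both products arise by overwriting coordinate k of a sample of `P` with an independent draw from
`Q k` or `P k`. Domination of the marginals therefore passes to the product, without a density on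
the infinite product. -/
theorem infinitePi_le_of_marginal_le {ι : Type*} {X : ι → Type*}
    [∀ i, MeasurableSpace (X i)] (P Q : ∀ i, Measure (X i)) [∀ i, IsProbabilityMeasure (P i)]
    [∀ i, IsProbabilityMeasure (Q i)] (k : ι) (h : ∀ i, i ≠ k → Q i = P i) {c : ℝ≥0∞}
    (hc : Q k ≤ c • P k) : Measure.infinitePi Q ≤ c • Measure.infinitePi P := by
  classical
  rw [infinitePi_eq_map_update P Q k h]
  conv_rhs => rw [infinitePi_eq_map_update P P k fun _ _ => rfl]
  have hm : Measurable fun p : X k × (∀ i, X i) => Function.update p.2 k p.1 := by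
    refine measurable_pi_lambda _ fun i => ?_
    by_cases hi : i = k
    · subst hi
      simpa using measurable_fst
    · simp only [Function.update_of_ne hi]
      exact (measurable_pi_apply i).comp measurable_snd
  rw [← Measure.map_smul]
  refine Measure.map_mono ?_ hm
  refine Measure.le_iff.2 fun E hE => ?_
  rw [Measure.smul_apply, smul_eq_mul, Measure.prod_apply hE, Measure.prod_apply hE,
    ← smul_eq_mul, ← lintegral_smul_measure]
  exact lintegral_mono' hc le_rfl

theorem infinitePi_stdLaplace_map_add_le {ι : Type*} (T : Finset ι) (v : ι → ℝ)
    (hv : ∀ k, k ∉ T → v k = 0) :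
    (Measure.infinitePi fun _ : ι => stdLaplace).map (fun ξ => ξ + v) ≤
      ENNReal.ofReal (Real.exp (∑ k ∈ T, |v k|)) • Measure.infinitePi fun _ : ι => stdLaplace := by
  classical
  induction T using Finset.induction_on generalizing v with
  | empty =>
    obtain rfl : v = 0 := funext fun k => hv k (by simp)
    simp
  | insert k T hk ih =>
    -- The shift in bin k is split off from the shift in the remaining bins, so the costs |v k| add
    -- up.
    have hsplit : (fun ξ : ι → ℝ => ξ + v) =
        (fun ξ => ξ + Pi.single k (v k)) ∘ fun ξ => ξ + Function.update v k 0 := by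
      funext ξ
      ext i
      by_cases hi : i = k
      · subst hi; simp
      · simp [hi]
    have hv' : ∀ i, i ∉ T → Function.update v k 0 i = 0 := by
      intro i hi
      by_cases hik : i = k
      · subst hik; simp
      · rw [Function.update_of_ne hik]
        exact hv i (by simp [hik, hi])
    have h1 := ih _ hv'
    have hsum : ∑ i ∈ T, |Function.update v k 0 i| = ∑ i ∈ T, |v i| := by
      refine Finset.sum_congr rfl fun i hi => ?_
      rw [Function.update_of_ne (ne_of_mem_of_not_mem hi hk)]
    rw [hsum] at h1
    have h2 : (Measure.infinitePi fun _ : ι => stdLaplace).map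
        (fun ξ => ξ + Pi.single k (v k)) ≤
        ENNReal.ofReal (Real.exp |v k|) • Measure.infinitePi fun _ : ι => stdLaplace := by
      have hp : ∀ i, IsProbabilityMeasure
          (stdLaplace.map fun x => x + Pi.single (M := fun _ => ℝ) k (v k) i) :=
        fun i => Measure.isProbabilityMeasure_map (by fun_prop)
      have := Measure.infinitePi_map_pi (fun _ : ι => stdLaplace)
        (f := fun i x => x + Pi.single (M := fun _ => ℝ) k (v k) i) (fun i => by fun_prop)
      have e : (fun ξ : ι → ℝ => ξ + Pi.single k (v k)) =
        fun x i => x i + Pi.single (M := fun _ => ℝ) k (v k) i := rfl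
      rw [e, this]
      refine infinitePi_le_of_marginal_le _ _ k (fun i hi => ?_) ?_
      · simp [hi]
      · simpa using stdLaplace_map_add_le (v k)
    rw [hsplit, ← Measure.map_map (by fun_prop) (by fun_prop), Finset.sum_insert hk, Real.exp_add,
      ENNReal.ofReal_mul (Real.exp_pos _).le]
    calc _ ≤ (ENNReal.ofReal (Real.exp (∑ k ∈ T, |v k|)) •
          Measure.infinitePi fun _ : ι => stdLaplace).map (fun ξ => ξ + Pi.single k (v k)) :=
          Measure.map_mono h1 (by fun_prop)
      _ = ENNReal.ofReal (Real.exp (∑ k ∈ T, |v k|)) • (Measure.infinitePi fun _ : ι =>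
          stdLaplace).map (fun ξ => ξ + Pi.single k (v k)) := Measure.map_smul _ _ _
      _ ≤ ENNReal.ofReal (Real.exp (∑ k ∈ T, |v k|)) • (ENNReal.ofReal (Real.exp |v k|) •
          Measure.infinitePi fun _ : ι => stdLaplace) := by
          refine Measure.le_iff.2 fun E _ => ?_
          rw [Measure.smul_apply, Measure.smul_apply]
          exact mul_le_mul_right (h2 E) _
      _ = _ := by rw [smul_smul, mul_comm]

/-- Shifting the noise in finitely many bins is a Hölder-dominated change of measure. -/
theorem holderDominated_infinitePi_stdLaplace {ι : Type*} (T : Finset ι) (v : ι → ℝ)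
    (hv : ∀ k, k ∉ T → v k = 0) {ε α β : ℝ} (hε : 0 < ε) (h : α.HolderConjugate β)
    (hsum : ∑ k ∈ T, |v k| ≤ ε) :
    HolderDominated β (ENNReal.ofReal (Real.exp ((α - 1 / 2) ^ 2 * ε ^ 2 / (2 * α))))
      ((Measure.infinitePi fun _ : ι => stdLaplace).map fun ξ => ξ + v)
      (Measure.infinitePi fun _ : ι => stdLaplace) := by
  set P := Measure.infinitePi fun _ : ι => stdLaplace
  have hm : Measurable fun ξ : ι → ℝ => ξ + v := by fun_prop
  have := Measure.isProbabilityMeasure_map (μ := P) hm.aemeasurable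
  have hle : ENNReal.ofReal (Real.exp (∑ k ∈ T, |v k|)) ≤ ENNReal.ofReal (Real.exp ε) :=
    ENNReal.ofReal_le_ofReal (Real.exp_le_exp.2 hsum)
  refine HolderDominated.of_pure hε h ?_ ?_
  · refine (infinitePi_stdLaplace_map_add_le T v hv).trans (Measure.le_iff.2 fun E _ => ?_)
    rw [Measure.smul_apply, Measure.smul_apply]
    exact mul_le_mul_left hle _
  · refine Measure.le_iff.2 fun E hE => ?_
    -- The reverse domination is the same bound for the opposite shift, evaluated on the translated
    -- event.
    have h1 := infinitePi_stdLaplace_map_add_le T (-v) (fun k hk => by simp [hv k hk])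
      ((fun ξ => ξ + v) ⁻¹' E)
    rw [Measure.map_apply (by fun_prop) (hm hE)] at h1
    have e : (fun ξ : ι → ℝ => ξ + -v) ⁻¹' ((fun ξ => ξ + v) ⁻¹' E) = E := by
      ext ξ; simp
    rw [e] at h1
    rw [Measure.smul_apply, Measure.map_apply hm hE]
    refine h1.trans ?_
    rw [Measure.smul_apply]
    simp only [Pi.neg_apply, abs_neg]
    exact mul_le_mul_left hle _

/-! ### The Gaussian release -/

instance isProbabilityMeasure_stdGaussianNoise (d : ℕ) :
    IsProbabilityMeasure (stdGaussianNoise d) := by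
  unfold stdGaussianNoise; infer_instance

instance isProbabilityMeasure_histNoise (d : ℕ) : IsProbabilityMeasure (histNoise d) := by
  unfold histNoise; infer_instance

theorem holderDominated_stdGaussianNoise {d : ℕ} {α β : ℝ} (h : α.HolderConjugate β)
    (w : Fin d → ℝ) {D : ℝ} (hD : ∑ j, w j ^ 2 ≤ D) :
    HolderDominated β (ENNReal.ofReal (Real.exp ((α - 1) * D / 2)))
      ((stdGaussianNoise d).map fun z => z + w) (stdGaussianNoise d) := by
  have hα : 1 < α := h.lt
  have e : (stdGaussianNoise d).map (fun z => z + w) =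
      Measure.pi fun j => gaussianReal (w j) 1 := by
    have hp : ∀ j, IsProbabilityMeasure ((gaussianReal 0 1).map fun x => x + w j) :=
      fun j => Measure.isProbabilityMeasure_map (by fun_prop)
    have := Measure.pi_map_pi (μ := fun _ : Fin d => gaussianReal 0 1)
      (f := fun j x => x + w j) (fun j => by fun_prop)
    simp only [gaussianReal_map_add_const, zero_add] at this
    exact this
  rw [e]
  refine (HolderDominated.pi h.symm.pos fun j => holderDominated_gaussianReal h (w j)).mono ?_
  rw [← ENNReal.ofReal_prod_of_nonneg fun j _ => (Real.exp_pos _).le, ← Real.exp_sum]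
  refine ENNReal.ofReal_le_ofReal (Real.exp_le_exp.2 ?_)
  rw [← Finset.sum_div, ← Finset.mul_sum]
  gcongr

/-- Translating the noise by (u - u')/s turns the release centered at u' into the one centered at u.
The Hölder bound is applied to an indicator, which equals its own β-th power. -/
theorem stdGaussianNoise_release_le {d : ℕ} {α β : ℝ} (h : α.HolderConjugate β)
    (u u' : Fin d → ℝ) {s D : ℝ} (hs : s ≠ 0) (hD : ∑ j, (u j - u' j) ^ 2 ≤ D * s ^ 2)
    {E : Set (Fin d → ℝ)} (hE : MeasurableSet E) :
    stdGaussianNoise d {z | (fun j => u j + s * z j) ∈ E} ≤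
      ENNReal.ofReal (Real.exp ((α - 1) * D / 2)) *
        stdGaussianNoise d {z | (fun j => u' j + s * z j) ∈ E} ^ (1 / β) := by
  set A : Set (Fin d → ℝ) := {z | (fun j => u' j + s * z j) ∈ E}
  have hA : MeasurableSet A := hE.preimage (by fun_prop)
  have hw : ∑ j, ((u j - u' j) / s) ^ 2 ≤ D := by
    simp_rw [div_pow]
    rw [← Finset.sum_div, div_le_iff₀ (by positivity)]
    exact hD
  have key := holderDominated_stdGaussianNoise h (fun j => (u j - u' j) / s) hw
    (A.indicator 1) (measurable_one.indicator hA)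
  have hβ : 0 < β := h.symm.pos
  have e1 : ∀ z, (A.indicator (1 : (Fin d → ℝ) → ℝ≥0∞) z) ^ β = A.indicator 1 z := by
    intro z
    by_cases hz : z ∈ A <;> simp [hz, hβ]
  simp_rw [e1] at key
  rw [lintegral_indicator_one hA, lintegral_indicator_one hA,
    Measure.map_apply (by fun_prop) hA] at key
  convert key using 3
  ext z
  have : (fun j => u' j + s * (z j + (u j - u' j) / s)) = fun j => u j + s * z j := by
    funext j
    field_simp
    ring
  simp [A, this]

/-- Adaptive composition: for fixed ξ the Gaussian release around `m ξ` is compared with the one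
around `m' (T ξ)`, giving a factor G(T ξ)^{1/β}. Changing measure along `T` raises this to the power
β, which restores G, so the two exponents simply add. -/
theorem adaptive_release_le {Ξ : Type*} [MeasurableSpace Ξ] {P : Measure Ξ}
    [IsProbabilityMeasure P] {d : ℕ} {α β t : ℝ} (h : α.HolderConjugate β) {T : Ξ → Ξ}
    (hT : Measurable T) {m m' : Ξ → Fin d → ℝ} (hm : Measurable m) (hm' : Measurable m')
    {s D : ℝ} (hs : s ≠ 0) (hD : ∀ ξ, ∑ j, (m ξ j - m' (T ξ) j) ^ 2 ≤ D * s ^ 2)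
    (hP : HolderDominated β (ENNReal.ofReal (Real.exp t)) (P.map T) P)
    {E : Set (Fin d → ℝ)} (hE : MeasurableSet E) :
    (P.prod (stdGaussianNoise d)) {ω | (fun j => m ω.1 j + s * ω.2 j) ∈ E} ≤
      ENNReal.ofReal (Real.exp (t + (α - 1) * D / 2)) *
      (P.prod (stdGaussianNoise d)) {ω | (fun j => m' ω.1 j + s * ω.2 j) ∈ E} ^ (1 / β) := by
  have hA : MeasurableSet {ω : Ξ × (Fin d → ℝ) | (fun j => m ω.1 j + s * ω.2 j) ∈ E} :=
    hE.preimage (by fun_prop)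
  have hA' : MeasurableSet {ω : Ξ × (Fin d → ℝ) | (fun j => m' ω.1 j + s * ω.2 j) ∈ E} :=
    hE.preimage (by fun_prop)
  rw [Measure.prod_apply hA, Measure.prod_apply hA']
  set G : Ξ → ℝ≥0∞ := fun ξ => stdGaussianNoise d (Prod.mk ξ ⁻¹'
    {ω : Ξ × (Fin d → ℝ) | (fun j => m' ω.1 j + s * ω.2 j) ∈ E}) with hG
  have hGm : Measurable G := measurable_measure_prodMk_left hA'
  have hβ : 0 < β := h.symm.pos
  calc _ ≤ ∫⁻ ξ, ENNReal.ofReal (Real.exp ((α - 1) * D / 2)) * G (T ξ) ^ (1 / β) ∂P :=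
        lintegral_mono fun ξ => stdGaussianNoise_release_le h (m ξ) (m' (T ξ)) hs (hD ξ) hE
    _ = ENNReal.ofReal (Real.exp ((α - 1) * D / 2)) *
        ∫⁻ ξ, G ξ ^ (1 / β) ∂(P.map T) := by
        rw [lintegral_map (hGm.pow_const _) hT, lintegral_const_mul]
        exact (hGm.comp hT).pow_const _
    _ ≤ ENNReal.ofReal (Real.exp ((α - 1) * D / 2)) * (ENNReal.ofReal (Real.exp t) *
        (∫⁻ ξ, (G ξ ^ (1 / β)) ^ β ∂P) ^ (1 / β)) := by
        gcongr
        exact hP _ (hGm.pow_const _)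
    _ = _ := by
        simp_rw [← ENNReal.rpow_mul, one_div_mul_cancel hβ.ne', ENNReal.rpow_one]
        rw [← mul_assoc, ← ENNReal.ofReal_mul (Real.exp_pos _).le, ← Real.exp_add, add_comm t]

/-! ### The histogram -/

theorem binFraction_congr {n : ℕ} {x x' : Fin n → ℝ} {I : Set ℝ}
    (h : ∀ i, x i ∈ I ↔ x' i ∈ I) : binFraction x I = binFraction x' I := by
  simp only [binFraction, h]

theorem binFraction_eq_zero_iff {n : ℕ} {x : Fin n → ℝ} {I : Set ℝ} :
    binFraction x I = 0 ↔ ∀ i, x i ∉ I := by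
  rcases Nat.eq_zero_or_pos n with rfl | hn
  · simp [binFraction]
  · simp only [binFraction, div_eq_zero_iff, Nat.cast_eq_zero, hn.ne', or_false,
      Set.ncard_eq_zero (Set.toFinite _), Set.eq_empty_iff_forall_notMem, Set.mem_ofPred_eq]

theorem binFraction_le_add {n : ℕ} {x x' : Fin n → ℝ} {i : Fin n} (h : ∀ j, j ≠ i → x j = x' j)
    (I : Set ℝ) : binFraction x I ≤ binFraction x' I + 1 / n := by
  have hsub : {j | x j ∈ I} ⊆ {j | x' j ∈ I} ∪ {i} := by
    intro j hj
    by_cases hji : j = i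
    · exact Or.inr hji
    · exact Or.inl (by simpa [← h j hji] using hj)
  have h1 : ({j | x j ∈ I}).ncard ≤ ({j | x' j ∈ I}).ncard + 1 :=
    ((Set.ncard_le_ncard hsub (Set.toFinite _)).trans (Set.ncard_union_le _ _)).trans
      (by simp)
  rw [binFraction, binFraction, ← add_div]
  gcongr
  exact_mod_cast h1

/-- The stability-based histogram of `x` in which also the bins without points of `x'` are
released as `0`. -/
noncomputable def maskedHistogram (ε δ : ℝ) {n : ℕ} (bins : ℤ → Set ℝ) (x x' : Fin n → ℝ)
    (ξ : ℤ → ℝ) (k : ℤ) : ℝ :=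
  open Classical in
  if binFraction x' (bins k) = 0 then 0 else stabilityHistogram ε δ bins x ξ k

/-- Masking makes the set of released bins symmetric in the two datasets. On those bins the shift,
scaled by 2/(εn), is exactly the difference of the fractions. -/
theorem maskedHistogram_add {ε δ : ℝ} (hε : 0 < ε) {n : ℕ} (hn : 0 < n) (bins : ℤ → Set ℝ)
    (x x' : Fin n → ℝ) (ξ : ℤ → ℝ) :
    maskedHistogram ε δ bins x' x
      (ξ + fun k => (binFraction x (bins k) - binFraction x' (bins k)) * (ε * n / 2)) =
      maskedHistogram ε δ bins x x' ξ := by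
  funext k
  have hn' : (0 : ℝ) < n := by exact_mod_cast hn
  by_cases h1 : binFraction x (bins k) = 0
  · by_cases h2 : binFraction x' (bins k) = 0 <;>
      simp [maskedHistogram, stabilityHistogram, h1, h2]
  · by_cases h2 : binFraction x' (bins k) = 0
    · simp [maskedHistogram, stabilityHistogram, h1, h2]
    · have : binFraction x' (bins k) + 2 / (ε * n) *
          (ξ k + (binFraction x (bins k) - binFraction x' (bins k)) * (ε * n / 2)) =
          binFraction x (bins k) + 2 / (ε * n) * ξ k := by
        field_simp
        ring
      simp only [maskedHistogram, stabilityHistogram, h1, h2, if_false, Pi.add_apply, this]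

/-- Masking can only matter in a bin that is empty for x' and occupied for x. Its only point is the
changed one, so its fraction is at most 1/n, and the noise bound keeps the value below the
threshold. -/
theorem stabilityHistogram_eq_masked {ε δ : ℝ} (hε : 0 < ε) {n : ℕ} {bins : ℤ → Set ℝ}
    {κ : ℝ → ℤ} (hκ : ∀ y k, y ∈ bins k ↔ κ y = k) {x x' : Fin n → ℝ} {i : Fin n}
    (h : ∀ j, j ≠ i → x j = x' j) {ξ : ℤ → ℝ} (hξ : ξ (κ (x i)) < Real.log (2 / δ)) :
    stabilityHistogram ε δ bins x ξ = maskedHistogram ε δ bins x x' ξ := by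
  funext k
  by_cases h2 : binFraction x' (bins k) = 0
  · by_cases h1 : binFraction x (bins k) = 0
    · simp [maskedHistogram, stabilityHistogram, h1, h2]
    · have hk : κ (x i) = k := by
        rw [binFraction_eq_zero_iff] at h1 h2
        push Not at h1
        obtain ⟨j, hj⟩ := h1
        by_cases hji : j = i
        · subst hji
          exact (hκ _ _).1 hj
        · exact absurd (h j hji ▸ hj) (h2 j)
      have hp := binFraction_le_add h (bins k)
      rw [h2, zero_add] at hp
      have hn : (0 : ℝ) < n := by exact_mod_cast i.pos
      have hlt : binFraction x (bins k) + 2 / (ε * n) * ξ k <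
          2 * Real.log (2 / δ) / (ε * n) + 1 / n := by
        rw [hk] at hξ
        have : 2 / (ε * n) * ξ k < 2 / (ε * n) * Real.log (2 / δ) := by gcongr
        calc _ < 1 / (n : ℝ) + 2 / (ε * n) * Real.log (2 / δ) := by linarith
          _ = _ := by ring
      simp only [maskedHistogram, stabilityHistogram, h1, h2, hlt, if_true, if_false]
  · simp [maskedHistogram, h2]

/-- Each fraction changes by at most 1/n, so each bin is shifted by at most ε/2. Taking the two bins
as a finset also covers the case where the changed point stays in its bin. -/
theorem binFraction_shift_sum_le {ε : ℝ} (hε : 0 < ε) {n : ℕ} {bins : ℤ → Set ℝ}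
    {x x' : Fin n → ℝ} {i : Fin n} (h : ∀ j, j ≠ i → x j = x' j) (k l : ℤ) :
    ∑ m ∈ {k, l},
      |(binFraction x (bins m) - binFraction x' (bins m)) * (ε * n / 2)| ≤ ε := by
  have hn : (0 : ℝ) < n := by exact_mod_cast i.pos
  have hb : ∀ m, |(binFraction x (bins m) - binFraction x' (bins m)) * (ε * n / 2)| ≤ ε / 2 := by
    intro m
    have h1 := binFraction_le_add h (bins m)
    have h2 := binFraction_le_add (fun j hj => (h j hj).symm) (bins m)
    rw [abs_mul, abs_of_pos (by positivity : 0 < ε * n / 2)]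
    calc _ ≤ 1 / (n : ℝ) * (ε * n / 2) := by
          gcongr
          rw [abs_le]
          constructor <;> linarith
      _ = ε / 2 := by field_simp
  calc _ ≤ ∑ m ∈ ({k, l} : Finset ℤ), ε / 2 := Finset.sum_le_sum fun m _ => hb m
    _ = (({k, l} : Finset ℤ).card : ℝ) * (ε / 2) := by rw [Finset.sum_const, nsmul_eq_mul]
    _ ≤ 2 * (ε / 2) := by
        gcongr
        exact_mod_cast Finset.card_le_two
    _ = ε := by ring

theorem binFraction_shift_eq_zero {ε : ℝ} {n : ℕ} {bins : ℤ → Set ℝ}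
    {κ : ℝ → ℤ} (hκ : ∀ y k, y ∈ bins k ↔ κ y = k) {x x' : Fin n → ℝ} {i : Fin n}
    (h : ∀ j, j ≠ i → x j = x' j) (k : ℤ) (hk : k ∉ ({κ (x i), κ (x' i)} : Finset ℤ)) :
    (binFraction x (bins k) - binFraction x' (bins k)) * (ε * n / 2) = 0 := by
  simp only [Finset.mem_insert, Finset.mem_singleton, not_or] at hk
  rw [binFraction_congr (x := x) (x' := x'), sub_self, zero_mul]
  intro j
  by_cases hj : j = i
  · subst hj
    rw [hκ, hκ]
    exact iff_of_false (Ne.symm hk.1) (Ne.symm hk.2)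
  · rw [h j hj]

theorem measurable_stabilityHistogram (ε δ : ℝ) {n : ℕ} (bins : ℤ → Set ℝ) (x : Fin n → ℝ) :
    Measurable fun ξ => stabilityHistogram ε δ bins x ξ := by
  refine measurable_pi_lambda _ fun k => ?_
  unfold stabilityHistogram
  split_ifs
  · exact measurable_const
  · exact Measurable.ite (measurableSet_lt (by fun_prop) measurable_const) measurable_const
      (by fun_prop)

theorem measurable_maskedHistogram (ε δ : ℝ) {n : ℕ} (bins : ℤ → Set ℝ) (x x' : Fin n → ℝ) :
    Measurable fun ξ => maskedHistogram ε δ bins x x' ξ := by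
  refine measurable_pi_lambda _ fun k => ?_
  unfold maskedHistogram
  split_ifs
  · exact measurable_const
  · exact (measurable_pi_apply k).comp (measurable_stabilityHistogram ε δ bins x)

theorem measurable_maxBin : Measurable maxBin := by
  have hA : ∀ n : ℕ, MeasurableSet {p : ℤ → ℝ | ∀ m, p m ≤ p (Equiv.intEquivNat.symm n)} := by
    intro n
    rw [Set.ofPred_forall]
    exact MeasurableSet.iInter fun m =>
      measurableSet_le (measurable_pi_apply m) (measurable_pi_apply _)
  refine measurable_to_countable' fun k => ?_
  have hN : MeasurableSet {p : ℤ → ℝ | ∃ n : ℕ, ∀ m, p m ≤ p (Equiv.intEquivNat.symm n)} := by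
    rw [Set.ofPred_exists]
    exact MeasurableSet.iUnion hA
  have hF : MeasurableSet ({p : ℤ → ℝ | ∀ m, p m ≤ p (Equiv.intEquivNat.symm
      (Equiv.intEquivNat k))} ∩ ⋂ n ∈ Set.Iio (Equiv.intEquivNat k),
        {p : ℤ → ℝ | ∀ m, p m ≤ p (Equiv.intEquivNat.symm n)}ᶜ) :=
    (hA _).inter (MeasurableSet.biInter (Set.to_countable _) fun n _ => (hA n).compl)
  -- Either k is the first maximizer in the enumeration, or there is no maximizer and k is the
  -- default 0; both are countable combinations of closed conditions.
  have hset : maxBin ⁻¹' {k} = ({p : ℤ → ℝ | ∀ m, p m ≤ p (Equiv.intEquivNat.symm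
      (Equiv.intEquivNat k))} ∩ ⋂ n ∈ Set.Iio (Equiv.intEquivNat k),
        {p : ℤ → ℝ | ∀ m, p m ≤ p (Equiv.intEquivNat.symm n)}ᶜ) ∪
      ({p : ℤ → ℝ | ∃ n : ℕ, ∀ m, p m ≤ p (Equiv.intEquivNat.symm n)}ᶜ ∩ {_p | k = 0}) := by
    ext p
    simp only [Set.mem_preimage, Set.mem_singleton_iff, Set.mem_union, Set.mem_inter_iff,
      Set.mem_ofPred_eq, Set.mem_iInter, Set.mem_compl_iff, Set.mem_Iio]
    by_cases h : ∃ n : ℕ, ∀ m, p m ≤ p (Equiv.intEquivNat.symm n)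
    · classical
      have e : maxBin p = Equiv.intEquivNat.symm (Nat.find h) := by
        rw [maxBin, dif_pos h]
      rw [e, Equiv.symm_apply_eq, Nat.find_eq_iff]
      simp only [h, not_true_eq_false, false_and, or_false]
    · rw [maxBin, dif_neg h]
      simp only [h, not_false_eq_true, true_and]
      have : ¬ ∀ m, p m ≤ p (Equiv.intEquivNat.symm (Equiv.intEquivNat k)) :=
        fun hh => h ⟨_, hh⟩
      simp only [this, false_and, false_or, eq_comm]
  rw [hset]
  exact hF.union (hN.compl.inter (MeasurableSet.const _))

/-! ### Privacy -/

/-- The index of the bin `(kτ, (k+1)τ]` containing a point. -/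
noncomputable def binIndex (τ y : ℝ) : ℤ := ⌈y / τ⌉ - 1

theorem mem_Ioc_iff_binIndex {τ : ℝ} (hτ : 0 < τ) (y : ℝ) (k : ℤ) :
    y ∈ Set.Ioc ((k : ℝ) * τ) ((k + 1) * τ) ↔ binIndex τ y = k := by
  rw [binIndex, sub_eq_iff_eq_add, Int.ceil_eq_iff, Set.mem_Ioc, lt_div_iff₀ hτ, div_le_iff₀ hτ]
  push_cast
  simp

theorem log_ratio_pos {d B : ℕ} {ζ : ℝ} (hd : 0 < d) (hB : 0 < B) (hζ : 0 < ζ) (hζ1 : ζ < 1) :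
    0 < Real.log (B * d / ζ) := by
  refine Real.log_pos ?_
  rw [one_lt_div hζ]
  have : (1 : ℝ) ≤ B * d := by exact_mod_cast Nat.mul_pos hB hd
  linarith

theorem truncRadius_pos {d B : ℕ} {ζ K a Λ : ℝ} (hd : 0 < d) (hB : 0 < B) (hζ : 0 < ζ)
    (hζ1 : ζ < 1) (hK : 0 < K) (hΛ : 0 < Λ) : 0 < truncRadius d B ζ K a Λ := by
  have := Real.rpow_pos_of_pos (log_ratio_pos hd hB hζ hζ1) a
  have := Real.sqrt_pos.2 hΛ
  unfold truncRadius
  positivity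

theorem binWidth_pos {K a Λ : ℝ} (hK : 0 < K) (hΛ : 0 < Λ) : 0 < binWidth K a Λ := by
  have := Real.rpow_pos_of_pos (Real.log_pos (show (1 : ℝ) < 25 by norm_num)) a
  have := Real.sqrt_pos.2 hΛ
  unfold binWidth
  positivity

/-- The mean of the points clipped to the box with half-width `r` and center `τ b`. -/
noncomputable def clippedMean {d B : ℕ} (τ r : ℝ) (g : Fin B → Fin d → ℝ) (b : Fin d → ℤ) :
    Fin d → ℝ :=
  empiricalMean fun i j => max ((b j : ℝ) * τ - r) (min ((b j : ℝ) * τ + r) (g i j))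

/-- Since both datasets are clipped to the same box, only the changed point contributes, and it
moves by at most the box width 2r in each coordinate. -/
theorem sum_sq_clippedMean_sub_le {d B : ℕ} (τ : ℝ) {r : ℝ} (hr : 0 ≤ r)
    {g g' : Fin B → Fin d → ℝ} {i : Fin B} (h : ∀ l, l ≠ i → g l = g' l) (b : Fin d → ℤ) :
    ∑ j, (clippedMean τ r g b j - clippedMean τ r g' b j) ^ 2 ≤ d * (2 * r / B) ^ 2 := by
  have hB : (0 : ℝ) < B := by exact_mod_cast i.pos
  have hj : ∀ j, (clippedMean τ r g b j - clippedMean τ r g' b j) ^ 2 ≤ (2 * r / B) ^ 2 := by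
    intro j
    have e : clippedMean τ r g b j - clippedMean τ r g' b j =
        (1 / (B : ℝ)) * (max ((b j : ℝ) * τ - r) (min ((b j : ℝ) * τ + r) (g i j)) -
          max ((b j : ℝ) * τ - r) (min ((b j : ℝ) * τ + r) (g' i j))) := by
      simp only [clippedMean, empiricalMean]
      rw [← mul_sub, ← Finset.sum_sub_distrib]
      congr 1
      refine Finset.sum_eq_single i (fun l _ hl => ?_) (fun hi => absurd (Finset.mem_univ i) hi)
      rw [h l hl, sub_self]
    have hb : ∀ y : ℝ, (b j : ℝ) * τ - r ≤ max ((b j : ℝ) * τ - r) (min ((b j : ℝ) * τ + r) y) ∧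
        max ((b j : ℝ) * τ - r) (min ((b j : ℝ) * τ + r) y) ≤ (b j : ℝ) * τ + r := fun y =>
      ⟨le_max_left _ _, max_le (by linarith) (min_le_left _ _)⟩
    rw [e]
    refine sq_le_sq' ?_ ?_
    · have h1 := (hb (g i j)).1
      have h2 := (hb (g' i j)).2
      rw [show -(2 * r / (B : ℝ)) = (1 / (B : ℝ)) * (-(2 * r)) by ring]
      gcongr
      linarith
    · have h1 := (hb (g i j)).2
      have h2 := (hb (g' i j)).1
      rw [show 2 * r / (B : ℝ) = (1 / (B : ℝ)) * (2 * r) by ring]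
      gcongr
      linarith
  calc _ ≤ ∑ _j : Fin d, (2 * r / (B : ℝ)) ^ 2 := Finset.sum_le_sum fun j _ => hj j
    _ = _ := by simp

theorem histNoise_eval_mem {d : ℕ} (j : Fin d) (k : ℤ) {A : Set ℝ} (hA : MeasurableSet A) :
    histNoise d {ξ | ξ j k ∈ A} = stdLaplace A := by
  have h1 : (histNoise d).map (fun ξ => ξ j) = Measure.infinitePi fun _ : ℤ => stdLaplace := by
    have := Measure.pi_map_eval (fun _ : Fin d => Measure.infinitePi fun _ : ℤ => stdLaplace) j
    simp only [measure_univ, Finset.prod_const_one, one_smul] at this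
    exact this
  have h2 : (histNoise d).map (fun ξ => ξ j k) = stdLaplace := by
    rw [← Measure.infinitePi_map_eval (fun _ : ℤ => stdLaplace) k, ← h1,
      Measure.map_map (by fun_prop) (by fun_prop)]
    rfl
  rw [← h2, Measure.map_apply (by fun_prop) hA]
  rfl

/-- The histogram index vector computed from the masked histograms. -/
noncomputable def maskedIndex {d B : ℕ} (ε δ τ : ℝ) (g g' : Fin B → Fin d → ℝ)
    (ξ : Fin d → ℤ → ℝ) (j : Fin d) : ℤ :=
  maxBin (maskedHistogram ε δ (fun k : ℤ => Set.Ioc (k * τ) ((k + 1) * τ))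
    (fun i => g i j) (fun i => g' i j) (ξ j))

theorem measurable_maskedIndex {d B : ℕ} (ε δ τ : ℝ) (g g' : Fin B → Fin d → ℝ) :
    Measurable (maskedIndex ε δ τ g g') :=
  measurable_pi_lambda _ fun j => measurable_maxBin.comp
    ((measurable_maskedHistogram ε δ _ _ _).comp (measurable_pi_apply j))

/-- The noise shift that turns the masked index of `g` into that of `g'`. -/
noncomputable def noiseShift {d B : ℕ} (ε τ : ℝ) (g g' : Fin B → Fin d → ℝ) (j : Fin d)
    (k : ℤ) : ℝ :=
  (binFraction (fun i => g i j) (Set.Ioc (k * τ) ((k + 1) * τ)) -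
    binFraction (fun i => g' i j) (Set.Ioc (k * τ) ((k + 1) * τ))) * (ε * B / 2)

theorem maskedIndex_add {d B : ℕ} {ε : ℝ} (δ τ : ℝ) (hε : 0 < ε) (hB : 0 < B)
    (g g' : Fin B → Fin d → ℝ) (ξ : Fin d → ℤ → ℝ) :
    maskedIndex ε δ τ g' g (ξ + noiseShift ε τ g g') = maskedIndex ε δ τ g g' ξ := by
  funext j
  exact congrArg maxBin (maskedHistogram_add hε hB
    (fun k : ℤ => Set.Ioc ((k : ℝ) * τ) ((k + 1) * τ)) (fun i => g i j) (fun i => g' i j) (ξ j))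

/-- The coordinates have independent noise, so the one-coordinate exponent is multiplied by d. In
each coordinate only the old and the new bin of the changed point are shifted. -/
theorem holderDominated_histNoise {d B : ℕ} {ε τ α β : ℝ} (hε : 0 < ε) (hτ : 0 < τ)
    (h : α.HolderConjugate β) {g g' : Fin B → Fin d → ℝ} {i : Fin B}
    (hg : ∀ l, l ≠ i → g l = g' l) :
    HolderDominated β (ENNReal.ofReal (Real.exp (d * ((α - 1 / 2) ^ 2 * ε ^ 2 / (2 * α)))))
      ((histNoise d).map fun ξ => ξ + noiseShift ε τ g g') (histNoise d) := by
  have e : (histNoise d).map (fun ξ => ξ + noiseShift ε τ g g') = Measure.pi fun j : Fin d =>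
      (Measure.infinitePi fun _ : ℤ => stdLaplace).map fun ξ => ξ + noiseShift ε τ g g' j := by
    have hp : ∀ j, IsProbabilityMeasure ((Measure.infinitePi fun _ : ℤ => stdLaplace).map
        fun ξ => ξ + noiseShift ε τ g g' j) :=
      fun j => Measure.isProbabilityMeasure_map (by fun_prop)
    exact Measure.pi_map_pi (μ := fun _ : Fin d => Measure.infinitePi fun _ : ℤ => stdLaplace)
      (f := fun j ξ => ξ + noiseShift ε τ g g' j) (fun j => by fun_prop)
  have hp : ∀ j, IsProbabilityMeasure ((Measure.infinitePi fun _ : ℤ => stdLaplace).map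
      fun ξ => ξ + noiseShift ε τ g g' j) :=
    fun j => Measure.isProbabilityMeasure_map (by fun_prop)
  rw [e]
  have hκ := mem_Ioc_iff_binIndex hτ
  have hj : ∀ j, HolderDominated β
      (ENNReal.ofReal (Real.exp ((α - 1 / 2) ^ 2 * ε ^ 2 / (2 * α))))
      ((Measure.infinitePi fun _ : ℤ => stdLaplace).map fun ξ => ξ + noiseShift ε τ g g' j)
      (Measure.infinitePi fun _ : ℤ => stdLaplace) := by
    intro j
    have hx : ∀ l, l ≠ i → (fun i => g i j) l = (fun i => g' i j) l :=
      fun l hl => congrFun (hg l hl) j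
    exact holderDominated_infinitePi_stdLaplace
      {binIndex τ (g i j), binIndex τ (g' i j)} (noiseShift ε τ g g' j)
      (fun k hk => binFraction_shift_eq_zero
        (bins := fun k : ℤ => Set.Ioc ((k : ℝ) * τ) ((k + 1) * τ)) hκ hx k hk) hε h
      (binFraction_shift_sum_le (bins := fun k : ℤ => Set.Ioc ((k : ℝ) * τ) ((k + 1) * τ))
        hε hx _ _)
  refine (HolderDominated.pi h.symm.pos hj).mono (le_of_eq ?_)
  rw [Finset.prod_const, ← ENNReal.ofReal_pow (Real.exp_pos _).le, ← Real.exp_nat_mul]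
  simp

/-- The noise for which masking may change the histogram. -/
theorem histNoise_unmask_le {d B : ℕ} {δ : ℝ} (hd : 0 < d) (hδ : 0 < δ) (τ : ℝ)
    (g : Fin B → Fin d → ℝ) (i : Fin B) :
    histNoise d {ξ | ∃ j, Real.log (2 / (δ / (4 * d))) ≤ ξ j (binIndex τ (g i j))} ≤
      ENNReal.ofReal (δ / 16) := by
  have hd' : (0 : ℝ) < d := by exact_mod_cast hd
  rw [Set.ofPred_exists]
  calc _ ≤ ∑' j, histNoise d {ξ | Real.log (2 / (δ / (4 * d))) ≤ ξ j (binIndex τ (g i j))} :=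
        measure_iUnion_le _
    _ ≤ ∑' _j : Fin d, ENNReal.ofReal (δ / (16 * d)) := by
        refine ENNReal.tsum_le_tsum fun j => ?_
        have := histNoise_eval_mem j (binIndex τ (g i j))
          (measurableSet_Ici (a := Real.log (2 / (δ / (4 * d)))))
        simp only [Set.mem_Ici] at this
        rw [this]
        -- The one-sided Laplace tail at log(8d/δ) is (1/2) · δ/(8d).
        refine (stdLaplace_Ici_le _).trans (ENNReal.ofReal_le_ofReal (le_of_eq ?_))
        rw [Real.exp_neg, Real.exp_log (by positivity)]
        field_simp
        norm_num
    _ = ENNReal.ofReal (δ / 16) := by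
        rw [tsum_fintype, Finset.sum_const, Finset.card_univ, Fintype.card_fin, nsmul_eq_mul,
          ← ENNReal.ofReal_natCast, ← ENNReal.ofReal_mul hd'.le]
        congr 1
        field_simp

/-- Outside the event controlled by `histNoise_unmask_le`, the mechanism is a Gaussian release
around a function of the masked index, the form required by `adaptive_release_le`. -/
theorem privateMean_eq_of_noise_lt {d B : ℕ} {ε δ ζ K a Λ : ℝ} (hd : 0 < d) (hε : 0 < ε)
    (hδ : 0 < δ) (hδ1 : δ < 1) (hK : 0 < K) (hΛ : 0 < Λ) {g g' : Fin B → Fin d → ℝ} {i : Fin B}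
    (hg : ∀ l, l ≠ i → g l = g' l) {ω : (Fin d → ℤ → ℝ) × (Fin d → ℝ)}
    (hω : ∀ j, ω.1 j (binIndex (binWidth K a Λ) (g i j)) < Real.log (2 / (δ / (4 * d)))) :
    privateMean ε δ ζ K a Λ g ω = fun j =>
      clippedMean (binWidth K a Λ) (truncRadius d B ζ K a Λ) g
        (maskedIndex (ε / (4 * √(2 * d * Real.log (4 / δ)))) (δ / (4 * d)) (binWidth K a Λ)
          g g' ω.1) j + noiseScale d B ε δ ζ K a Λ * ω.2 j := by
  have hd' : (0 : ℝ) < d := by exact_mod_cast hd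
  have hℓ : 0 < Real.log (4 / δ) := Real.log_pos (by rw [one_lt_div hδ]; linarith)
  have hε' : 0 < ε / (4 * √(2 * d * Real.log (4 / δ))) := by positivity
  have hb : boxCenter ε δ K a Λ g ω.1 = fun j => ((maskedIndex
      (ε / (4 * √(2 * d * Real.log (4 / δ)))) (δ / (4 * d)) (binWidth K a Λ)
          g g' ω.1 j : ℤ) : ℝ) * binWidth K a Λ := by
    funext j
    rw [boxCenter, maskedIndex, stabilityHistogram_eq_masked hε'
      (mem_Ioc_iff_binIndex (binWidth_pos hK hΛ)) (fun l hl => congrFun (hg l hl) j) (hω j)]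
  funext j
  simp only [privateMean, clippedMean, empiricalMean, truncated, hb]

/-! ### Choice of the Rényi order and assembly of the privacy bound -/

/-- The parameters of the mechanism satisfy the constraint of the Rényi accounting. -/
theorem renyi_budget {d : ℕ} {ε δ : ℝ} (hd : 0 < d) (hε : 0 < ε) (hε1 : ε < 0.9) (hδ : 0 < δ)
    (hδ1 : δ < 1) {α : ℝ} (hα : α - 1 = 2 * Real.log (2.5 / δ) / ε) :
    α * (d * ((α - 1 / 2) ^ 2 * (ε / (4 * √(2 * d * Real.log (4 / δ)))) ^ 2 / (2 * α)) +
      (α - 1) * (ε ^ 2 / (8 * Real.log (2.5 / δ))) / 2) - (α - 1) * ε ≤ Real.log (δ / 2) := by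
  have hd' : (0 : ℝ) < d := by exact_mod_cast hd
  -- Together with ε < 0.9 this gives ε ≤ log(2.5/δ), which absorbs the lower order terms in ε
  -- below.
  have hℓ' : 0.9 ≤ Real.log (2.5 / δ) := by
    have h1 : (2.5 : ℝ) ≤ 2.5 / δ := by rw [le_div_iff₀ hδ]; nlinarith
    have h2 := Real.log_le_log (by norm_num) h1
    have h3 : (0.9 : ℝ) ≤ Real.log 2.5 := by
      rw [Real.le_log_iff_exp_le (by norm_num)]
      have e : Real.exp 0.9 = Real.exp (-0.1) * Real.exp 1 := by rw [← Real.exp_add]; norm_num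
      have h4 := Real.exp_one_lt_d9
      have h5 : Real.exp (-0.1) ≤ 1 / 1.1 := by
        rw [Real.exp_neg, ← one_div]
        exact one_div_le_one_div_of_le (by norm_num) (by linarith [Real.add_one_le_exp (0.1 : ℝ)])
      rw [e]
      nlinarith [Real.exp_pos (-0.1), Real.exp_pos 1]
    linarith
  have hℓ : Real.log (2.5 / δ) ≤ Real.log (4 / δ) :=
    Real.log_le_log (by positivity) (by gcongr; norm_num)
  have hlog : Real.log (δ / 2) = -Real.log (2 / δ) := by
    rw [← Real.log_inv, inv_div]
  have hℓ2 : Real.log (2 / δ) ≤ Real.log (2.5 / δ) :=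
    Real.log_le_log (by positivity) (by gcongr; norm_num)
  set L := Real.log (2.5 / δ)
  set M := Real.log (4 / δ)
  have hM : 0 < M := by linarith
  have hL : 0 < L := by linarith
  rw [hlog, div_pow, mul_pow, Real.sq_sqrt (by positivity)]
  obtain ⟨l, hl⟩ : ∃ l, l = α - 1 := ⟨_, rfl⟩
  have hlε : l * ε = 2 * L := by rw [hl, hα]; field_simp
  have hl0 : 0 < l := by rw [hl, hα]; positivity
  have hαl : α = l + 1 := by linarith
  -- In terms of l = α - 1, with lε = 2L, the three terms are the histogram cost, the Gaussian cost
  -- and the gain. They are at most 0.1 L, at most 0.4 L, and equal to -2L, so the total is at most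
  -- -1.5 L ≤ -log(2/δ).
  have e1 : α * (d * ((α - 1 / 2) ^ 2 * (ε ^ 2 / (4 ^ 2 * (2 * d * M))) / (2 * α)) +
      (α - 1) * (ε ^ 2 / (8 * L)) / 2) - (α - 1) * ε =
      ((l + 1 / 2) * ε) ^ 2 / (64 * M) + (l * ε * (l * ε + ε)) / (16 * L) - l * ε := by
    have : l + 1 ≠ 0 := by linarith
    rw [hαl]
    field_simp
    ring
  rw [e1]
  have e2 : (l + 1 / 2) * ε = 2 * L + ε / 2 := by rw [add_mul, hlε]; ring
  rw [e2, hlε]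
  have h1 : (2 * L + ε / 2) ^ 2 / (64 * M) ≤ (2 * L + ε / 2) ^ 2 / (64 * L) := by gcongr
  have h2 : (2 * L + ε / 2) ^ 2 / (64 * L) ≤ (2.5 * L) ^ 2 / (64 * L) := by
    gcongr
    linarith
  have h3 : (2.5 * L) ^ 2 / (64 * L) ≤ 0.1 * L := by
    rw [div_le_iff₀ (by positivity)]
    nlinarith
  have h4 : (2 * L * (2 * L + ε)) / (16 * L) ≤ 0.4 * L := by
    rw [div_le_iff₀ (by positivity)]
    nlinarith
  linarith

/-- The noise scale is calibrated so that equality holds: s = 4r√(2dL)/(εB) with L = log(2.5/δ). -/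
theorem noiseScale_sensitivity {d B : ℕ} {ε δ ζ K a Λ : ℝ} (hd : 0 < d) (hB : 0 < B) (hε : 0 < ε)
    (hδ : 0 < δ) (hδ1 : δ < 1) :
    d * (2 * truncRadius d B ζ K a Λ / B) ^ 2 ≤
      ε ^ 2 / (8 * Real.log (2.5 / δ)) * noiseScale d B ε δ ζ K a Λ ^ 2 := by
  have hd' : (0 : ℝ) < d := by exact_mod_cast hd
  have hB' : (0 : ℝ) < B := by exact_mod_cast hB
  have hL : 0 < Real.log (2.5 / δ) := Real.log_pos (by rw [one_lt_div hδ]; linarith)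
  have e : noiseScale d B ε δ ζ K a Λ =
      4 * truncRadius d B ζ K a Λ * √(2 * d * Real.log (2.5 / δ)) / (ε * B) := by
    rw [noiseScale, truncRadius]; ring
  rw [e, div_pow _ (ε * (B : ℝ)), mul_pow _ √_, Real.sq_sqrt (by positivity)]
  refine le_of_eq ?_
  field_simp
  ring

/-- The loss consists of δ/2 from the Rényi conversion and δ/16 from masking each dataset; the mask
of the second dataset enters multiplied by e^ε. -/
theorem exp_weight_le {ε δ : ℝ} (hε1 : ε < 0.9) (hδ : 0 < δ) :
    Real.exp ε * (δ / 16) + δ / 2 + δ / 16 ≤ δ := by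
  have h : Real.exp ε ≤ 2.7182818286 :=
    (Real.exp_le_exp.2 (by linarith : ε ≤ 1)).trans Real.exp_one_lt_d9.le
  nlinarith

theorem privateMean_isDifferentiallyPrivate (d B : ℕ) (ε δ ζ K a Λ : ℝ) (hε : 0 < ε)
    (hε1 : ε < 0.9) (hδ : 0 < δ) (hδ1 : δ < 1) (hζ : 0 < ζ) (hζ1 : ζ < 1) (hK : 0 < K)
    (hΛ : 0 < Λ) :
    IsDifferentiallyPrivate (n := B) (X := Fin d → ℝ) (privateMeanNoise d)
      (privateMean ε δ ζ K a Λ) ε δ := by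
  rintro g g' ⟨i, hg⟩ E hE
  rcases Nat.eq_zero_or_pos d with rfl | hd
  -- In dimension 0 the output space is a single point.
  · have : ∀ ω, privateMean ε δ ζ K a Λ g ω = privateMean ε δ ζ K a Λ g' ω :=
      fun ω => Subsingleton.elim _ _
    simp only [this]
    refine le_add_right ?_
    exact le_mul_of_one_le_left' (by simpa using hε.le)
  have hB : 0 < B := i.pos
  have hd' : (0 : ℝ) < d := by exact_mod_cast hd
  have hL : 0 < Real.log (2.5 / δ) := Real.log_pos (by rw [one_lt_div hδ]; linarith)
  have hM : 0 < Real.log (4 / δ) := Real.log_pos (by rw [one_lt_div hδ]; linarith)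
  set ε₀ := ε / (4 * √(2 * d * Real.log (4 / δ))) with hε₀
  have hε₀pos : 0 < ε₀ := by positivity
  set τ := binWidth K a Λ with hτdef
  have hτ : 0 < τ := binWidth_pos hK hΛ
  set r := truncRadius d B ζ K a Λ with hrdef
  have hr : 0 < r := truncRadius_pos hd hB hζ hζ1 hK hΛ
  set s := noiseScale d B ε δ ζ K a Λ with hsdef
  have hs : s ≠ 0 := by
    have h1 := noiseScale_sensitivity (ζ := ζ) (K := K) (a := a) (Λ := Λ) hd hB hε hδ hδ1
    intro h0
    rw [← hsdef, h0, ← hrdef] at h1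
    have hB' : (0 : ℝ) < B := by exact_mod_cast hB
    have : 0 < (d : ℝ) * (2 * r / B) ^ 2 := by positivity
    norm_num at h1
    linarith
  set m := fun ξ => clippedMean τ r g (maskedIndex ε₀ (δ / (4 * d)) τ g g' ξ)
  set m' := fun ξ => clippedMean τ r g' (maskedIndex ε₀ (δ / (4 * d)) τ g' g ξ)
  -- The box depends on the noise only through an index vector in a countable space, so any function
  -- of it is measurable.
  have hm : Measurable m := (measurable_of_countable (clippedMean τ r g)).comp
    (measurable_maskedIndex ε₀ (δ / (4 * d)) τ g g')
  have hm' : Measurable m' := (measurable_of_countable (clippedMean τ r g')).comp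
    (measurable_maskedIndex ε₀ (δ / (4 * d)) τ g' g)
  obtain ⟨α, hα⟩ : ∃ α, α - 1 = 2 * Real.log (2.5 / δ) / ε := ⟨_, add_sub_cancel_right _ 1⟩
  have hα1 : 1 < α := by
    have : 0 < 2 * Real.log (2.5 / δ) / ε := by positivity
    linarith
  have hαβ := Real.HolderConjugate.conjExponent hα1
  have hD : ∀ ξ, ∑ j, (m ξ j - m' (ξ + noiseShift ε₀ τ g g') j) ^ 2 ≤
      ε ^ 2 / (8 * Real.log (2.5 / δ)) * s ^ 2 := by
    intro ξ
    simp only [m, m', maskedIndex_add (δ / (4 * d)) τ hε₀pos hB g g' ξ]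
    exact (sum_sq_clippedMean_sub_le τ hr.le hg _).trans
      (noiseScale_sensitivity hd hB hε hδ hδ1)
  have key := le_mul_add_of_le_mul_rpow (ε := ε) hαβ (adaptive_release_le hαβ
    (show Measurable fun ξ => ξ + noiseShift ε₀ τ g g' by fun_prop) hm hm' hs hD
    (holderDominated_histNoise hε₀pos hτ hαβ hg) hE)
  have hbudget := renyi_budget hd hε hε1 hδ hδ1 hα
  have key2 : (privateMeanNoise d) {ω | (fun j => m ω.1 j + s * ω.2 j) ∈ E} ≤
      ENNReal.ofReal (Real.exp ε) *
        (privateMeanNoise d) {ω | (fun j => m' ω.1 j + s * ω.2 j) ∈ E} +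
      ENNReal.ofReal (δ / 2) := by
    refine key.trans (add_le_add le_rfl (ENNReal.ofReal_le_ofReal ?_))
    rw [← Real.exp_log (show 0 < δ / 2 by positivity)]
    exact Real.exp_le_exp.2 hbudget
  have hbad : ∀ f : Fin B → Fin d → ℝ, privateMeanNoise d {ω | ∃ j,
      Real.log (2 / (δ / (4 * d))) ≤ ω.1 j (binIndex τ (f i j))} ≤ ENNReal.ofReal (δ / 16) := by
    intro f
    have : {ω : (Fin d → ℤ → ℝ) × (Fin d → ℝ) | ∃ j,
        Real.log (2 / (δ / (4 * d))) ≤ ω.1 j (binIndex τ (f i j))} =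
        {ξ | ∃ j, Real.log (2 / (δ / (4 * d))) ≤ ξ j (binIndex τ (f i j))} ×ˢ Set.univ := by
      ext ω; simp
    rw [this, privateMeanNoise, Measure.prod_prod, measure_univ, mul_one]
    exact histNoise_unmask_le hd hδ τ f i
  have h1 : (privateMeanNoise d) {ω | privateMean ε δ ζ K a Λ g ω ∈ E} ≤
      (privateMeanNoise d) {ω | (fun j => m ω.1 j + s * ω.2 j) ∈ E} +
        ENNReal.ofReal (δ / 16) := by
    refine (measure_mono ?_).trans ((measure_union_le _ _).trans (add_le_add le_rfl (hbad g)))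
    intro ω hω
    by_cases hb : ∃ j, Real.log (2 / (δ / (4 * d))) ≤ ω.1 j (binIndex τ (g i j))
    · exact Or.inr hb
    · push Not at hb
      left
      have := privateMean_eq_of_noise_lt (ζ := ζ) hd hε hδ hδ1 hK hΛ hg hb
      change privateMean ε δ ζ K a Λ g ω ∈ E at hω
      rw [this] at hω
      exact hω
  have h2 : (privateMeanNoise d) {ω | (fun j => m' ω.1 j + s * ω.2 j) ∈ E} ≤
      (privateMeanNoise d) {ω | privateMean ε δ ζ K a Λ g' ω ∈ E} + ENNReal.ofReal (δ / 16) := by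
    refine (measure_mono ?_).trans ((measure_union_le _ _).trans (add_le_add le_rfl (hbad g')))
    intro ω hω
    by_cases hb : ∃ j, Real.log (2 / (δ / (4 * d))) ≤ ω.1 j (binIndex τ (g' i j))
    · exact Or.inr hb
    · push Not at hb
      left
      have := privateMean_eq_of_noise_lt (ζ := ζ) hd hε hδ hδ1 hK hΛ
        (fun l hl => (hg l hl).symm) hb
      show privateMean ε δ ζ K a Λ g' ω ∈ E
      rw [this]
      exact hω
  calc _ ≤ _ := h1
    _ ≤ _ := add_le_add key2 le_rfl
    _ ≤ (ENNReal.ofReal (Real.exp ε) * ((privateMeanNoise d)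
          {ω | privateMean ε δ ζ K a Λ g' ω ∈ E} + ENNReal.ofReal (δ / 16)) +
          ENNReal.ofReal (δ / 2)) + ENNReal.ofReal (δ / 16) := by gcongr
    _ = ENNReal.ofReal (Real.exp ε) * (privateMeanNoise d)
          {ω | privateMean ε δ ζ K a Λ g' ω ∈ E} +
          ENNReal.ofReal (Real.exp ε * (δ / 16) + δ / 2 + δ / 16) := by
        rw [ENNReal.ofReal_add (by positivity) (by positivity),
          ENNReal.ofReal_add (by positivity) (by positivity),
          ENNReal.ofReal_mul (Real.exp_pos _).le]
        ring
    _ ≤ _ := by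
        gcongr
        exact exp_weight_le hε1 hδ

/-! ### Tails of the gradients -/

theorem measurable_matrix_entry {m n : Type*} (i : m) (j : n) :
    Measurable fun A : Matrix m n ℝ => A i j :=
  (measurable_pi_apply j).comp (measurable_pi_apply (X := fun _ : m => n → ℝ) i)

theorem measurable_matrix_mulVec {d : ℕ} (u : Fin d → ℝ) (j : Fin d) :
    Measurable fun A : Matrix (Fin d) (Fin d) ℝ => A.mulVec u j := by
  simp only [Matrix.mulVec, dotProduct]
  exact Finset.measurable_sum _ fun i _ => (measurable_matrix_entry j i).mul_const _

theorem Hmat_smul {d : ℕ} (μ : Measure (Matrix (Fin d) (Fin d) ℝ))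
    (S : Matrix (Fin d) (Fin d) ℝ) (c : ℝ) (u : Fin d → ℝ) :
    Hmat μ S (c • u) = c ^ 2 • Hmat μ S u := by
  rw [Hmat, Hmat, smul_comm]
  congr 1
  ext i j
  simp only [Matrix.of_apply, Matrix.smul_apply, smul_eq_mul]
  rw [← integral_const_mul]
  congr 1
  funext A
  have : Matrix.vecMulVec (c • u) (c • u) = c ^ 2 • Matrix.vecMulVec u u := by
    ext k l
    simp only [Matrix.vecMulVec_apply, Pi.smul_apply, smul_eq_mul, Matrix.smul_apply]
    ring
  rw [this, Matrix.mul_smul, Matrix.smul_mul, Matrix.smul_apply, smul_eq_mul]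

theorem spectralNorm₂_smul {d : ℕ} {c : ℝ} (hc : 0 ≤ c) (X : Matrix (Fin d) (Fin d) ℝ) :
    spectralNorm₂ (c • X) = c * spectralNorm₂ X := by
  rw [spectralNorm₂, spectralNorm₂, map_smul, norm_smul, Real.norm_of_nonneg hc]

/-- Markov's inequality for the exponential moment, tested on the normalized u and the basis vector
e_j. The power 1/(2a) inverts the squared deviation K²V log^{2a} x, leaving exp(log x) = x. -/
theorem GradientModel.tail_le {d : ℕ} {μ : Measure (Matrix (Fin d) (Fin d) ℝ)}
    {S : Matrix (Fin d) (Fin d) ℝ} {K a : ℝ} (hM : GradientModel μ S K a) {u : Fin d → ℝ}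
    (hV : 0 < topEigenvalue S ^ 2 * spectralNorm₂ (Hmat μ S u)) (j : Fin d) {x : ℝ}
    (hx : 1 < x) :
    μ {A | K * √(topEigenvalue S ^ 2 * spectralNorm₂ (Hmat μ S u)) * Real.log x ^ a ≤
      |A.mulVec u j - S.mulVec u j|} ≤ ENNReal.ofReal (2 / x) := by
  have hK := hM.K_pos
  have ha := hM.a_pos
  set V := topEigenvalue S ^ 2 * spectralNorm₂ (Hmat μ S u) with hVdef
  -- H_0 = 0 would make V vanish, so u can be normalized.
  have hu : u ≠ 0 := by
    rintro rfl
    have : Hmat μ S (0 : Fin d → ℝ) = 0 := by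
      have := Hmat_smul μ S 0 (0 : Fin d → ℝ)
      simpa using this
    rw [hVdef, this] at hV
    simp [spectralNorm₂] at hV
  have huu : 0 < dotProduct u u := by
    have h1 : 0 ≤ dotProduct u u := Finset.sum_nonneg fun i _ => mul_self_nonneg _
    exact lt_of_le_of_ne h1 (Ne.symm (by rwa [Ne, dotProduct_self_eq_zero]))
  set c := √(dotProduct u u) with hc
  have hc0 : 0 < c := Real.sqrt_pos.2 huu
  have hcc : c * c = dotProduct u u := Real.mul_self_sqrt huu.le
  set w := c⁻¹ • u with hw
  have huw : u = c • w := by rw [hw, smul_smul, mul_inv_cancel₀ hc0.ne', one_smul]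
  have hww : dotProduct w w = 1 := by
    rw [hw, smul_dotProduct, dotProduct_smul, smul_eq_mul, smul_eq_mul, ← hcc]
    field_simp
  -- H_u is quadratic in u, so the tail ratio is unchanged when u is normalized.
  have hVw : V = c ^ 2 * (topEigenvalue S ^ 2 * spectralNorm₂ (Hmat μ S w)) := by
    rw [hVdef, huw, Hmat_smul, spectralNorm₂_smul (by positivity)]
    ring
  have hee : dotProduct (Pi.single j (1 : ℝ)) (Pi.single j (1 : ℝ)) = 1 := by simp
  have key := hM.tail w (Pi.single j 1) hww hee
  -- Symmetry of Σ identifies column j of Aᵀ - Σ with row j of A - Σ.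
  have hS : ∀ i, S i j = S j i := by
    intro i
    have := hM.posSemidef.isHermitian.apply i j
    simpa using this.symm
  have hX : ∀ A : Matrix (Fin d) (Fin d) ℝ,
      dotProduct w ((A.transpose - S).mulVec (Pi.single j 1)) =
        c⁻¹ * (A.mulVec u j - S.mulVec u j) := by
    intro A
    rw [Matrix.mulVec_single_one, hw, smul_dotProduct, smul_eq_mul]
    simp only [dotProduct, Matrix.mulVec, Matrix.col_apply, Matrix.sub_apply,
      Matrix.transpose_apply]
    rw [← Finset.sum_sub_distrib]
    congr 1
    refine Finset.sum_congr rfl fun i _ => ?_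
    rw [hS i]
    ring
  have hratio : ∀ A : Matrix (Fin d) (Fin d) ℝ,
      |dotProduct w ((A.transpose - S).mulVec (Pi.single j 1))| ^ 2 /
        (K ^ 2 * topEigenvalue S ^ 2 * spectralNorm₂ (Hmat μ S w)) =
      (A.mulVec u j - S.mulVec u j) ^ 2 / (K ^ 2 * V) := by
    intro A
    rw [hX, sq_abs, mul_pow, hVw, mul_assoc, inv_pow, ← mul_left_comm (c ^ 2),
      inv_mul_eq_div, div_div]
  simp_rw [hratio] at key
  have hmeas : Measurable fun A : Matrix (Fin d) (Fin d) ℝ => ENNReal.ofReal (Real.exp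
      (((A.mulVec u j - S.mulVec u j) ^ 2 / (K ^ 2 * V)) ^ (1 / (2 * a)))) := by
    have := measurable_matrix_mulVec u j
    fun_prop
  have hlog : 0 < Real.log x := Real.log_pos hx
  have hsub : {A : Matrix (Fin d) (Fin d) ℝ | K * √V * Real.log x ^ a ≤
      |A.mulVec u j - S.mulVec u j|} ⊆ {A | ENNReal.ofReal x ≤ ENNReal.ofReal (Real.exp
      (((A.mulVec u j - S.mulVec u j) ^ 2 / (K ^ 2 * V)) ^ (1 / (2 * a))))} := by
    intro A hA
    have hA' : K * √V * Real.log x ^ a ≤ |A.mulVec u j - S.mulVec u j| := hA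
    refine ENNReal.ofReal_le_ofReal ?_
    rw [← Real.log_le_iff_le_exp (by linarith)]
    have h1 : Real.log x ^ (2 * a) ≤ (A.mulVec u j - S.mulVec u j) ^ 2 / (K ^ 2 * V) := by
      rw [le_div_iff₀ (by positivity), ← sq_abs (A.mulVec u j - S.mulVec u j)]
      calc Real.log x ^ (2 * a) * (K ^ 2 * V) = (K * √V * Real.log x ^ a) ^ 2 := by
            rw [mul_pow, mul_pow, Real.sq_sqrt hV.le, ← Real.rpow_mul_natCast hlog.le]
            push_cast
            rw [mul_comm a 2]
            ring
        _ ≤ _ := by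
            have := Real.rpow_nonneg hlog.le a
            gcongr
    calc Real.log x = (Real.log x ^ (2 * a)) ^ (1 / (2 * a)) := by
          rw [← Real.rpow_mul hlog.le, mul_one_div_cancel (by positivity), Real.rpow_one]
      _ ≤ _ := by gcongr
  refine (measure_mono hsub).trans ((meas_ge_le_lintegral_div hmeas.aemeasurable
    (by simp; linarith) ENNReal.ofReal_ne_top).trans ?_)
  rw [ENNReal.ofReal_div_of_pos (by linarith)]
  gcongr
  simpa using key

/-! ### The winning bin -/

theorem le_maxBin {p : ℤ → ℝ} (h : ∃ k, ∀ m, p m ≤ p k) (m : ℤ) : p m ≤ p (maxBin p) := by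
  classical
  have h' : ∃ n : ℕ, ∀ m, p m ≤ p (Equiv.intEquivNat.symm n) := by
    obtain ⟨k, hk⟩ := h
    exact ⟨Equiv.intEquivNat k, by simpa using hk⟩
  rw [maxBin, dif_pos h']
  exact Nat.find_spec h' m

/-- The fraction of points in a bin without inliers is at most the fraction of outliers. -/
theorem binFraction_le_of_no_inlier {n : ℕ} {y : Fin n → ℝ} {m τ : ℝ} {I : Set ℝ}
    (hI : ∀ i, y i ∈ I → τ ≤ |y i - m|) :
    binFraction y I ≤ (Set.ncard {i | τ ≤ |y i - m|} : ℝ) / n := by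
  rw [binFraction]
  have : Set.ncard {i | y i ∈ I} ≤ Set.ncard {i | τ ≤ |y i - m|} :=
    Set.ncard_le_ncard hI (Set.toFinite _)
  gcongr

/-- Points within τ of m lie in the bin of m or in one of its two neighbors. At least 4/5 of all
points share three bins, so one bin has at least 4/15. -/
theorem exists_binFraction_ge {n : ℕ} (hn : 0 < n) {y : Fin n → ℝ} {m τ : ℝ} (hτ : 0 < τ)
    (hout : (Set.ncard {i | τ ≤ |y i - m|} : ℝ) ≤ n / 5) :
    ∃ k : ℤ, 4 / 15 ≤ binFraction y (Set.Ioc ((k : ℝ) * τ) ((k + 1) * τ)) := by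
  have hn' : (0 : ℝ) < n := by exact_mod_cast hn
  by_contra! hcon
  set k₀ := binIndex τ m with hk₀
  have hm := (mem_Ioc_iff_binIndex hτ m k₀).2 rfl
  set N : ℤ → ℕ := fun k => Set.ncard {i | y i ∈ Set.Ioc ((k : ℝ) * τ) ((k + 1) * τ)} with hN
  have hNlt : ∀ k, (N k : ℝ) < 4 / 15 * n := by
    intro k
    have := hcon k
    rwa [binFraction, div_lt_iff₀ hn'] at this
  have hcover : (Set.univ : Set (Fin n)) ⊆ {i | τ ≤ |y i - m|} ∪
      ({i | y i ∈ Set.Ioc (((k₀ - 1 : ℤ) : ℝ) * τ) (((k₀ - 1 : ℤ) + 1) * τ)} ∪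
      ({i | y i ∈ Set.Ioc ((k₀ : ℝ) * τ) ((k₀ + 1) * τ)} ∪
       {i | y i ∈ Set.Ioc (((k₀ + 1 : ℤ) : ℝ) * τ) (((k₀ + 1 : ℤ) + 1) * τ)})) := by
    intro i _
    by_cases hi : τ ≤ |y i - m|
    · exact Or.inl hi
    right
    rw [not_le, abs_lt] at hi
    obtain ⟨h1, h2⟩ := hm
    simp only [Set.mem_union, Set.mem_ofPred_eq, Set.mem_Ioc]
    push_cast
    by_cases h3 : y i ≤ k₀ * τ
    · left; constructor <;> nlinarith
    by_cases h4 : y i ≤ (k₀ + 1) * τ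
    · right; left; exact ⟨not_le.1 h3, h4⟩
    · right; right; constructor <;> nlinarith
  have hcard : n ≤ Set.ncard {i | τ ≤ |y i - m|} + (N (k₀ - 1) + (N k₀ + N (k₀ + 1))) := by
    calc n = (Set.univ : Set (Fin n)).ncard := by simp
      _ ≤ _ := Set.ncard_le_ncard hcover (Set.toFinite _)
      _ ≤ _ := (Set.ncard_union_le _ _).trans (add_le_add le_rfl
        ((Set.ncard_union_le _ _).trans (add_le_add le_rfl (Set.ncard_union_le _ _))))
  have hcard' : (n : ℝ) ≤ Set.ncard {i | τ ≤ |y i - m|} +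
      (N (k₀ - 1) + (N k₀ + N (k₀ + 1))) := by exact_mod_cast hcard
  linarith [hNlt (k₀ - 1), hNlt k₀, hNlt (k₀ + 1)]

/-- If few points are outliers and the noise and the threshold are small, the winning bin contains
an inlier, so that its left end point is close to the center. -/
theorem abs_maxBin_sub_le {n : ℕ} (hn : 0 < n) {y : Fin n → ℝ} {m τ ε δ : ℝ} (hτ : 0 < τ)
    {ξ : ℤ → ℝ} (hout : (Set.ncard {i | τ ≤ |y i - m|} : ℝ) ≤ n / 5)
    (hξ : ∀ i, |2 / (ε * n) * ξ (binIndex τ (y i))| ≤ 1 / 60)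
    (hthr : 2 * Real.log (2 / δ) / (ε * n) + 1 / n ≤ 1 / 5) :
    |(maxBin (stabilityHistogram ε δ (fun k : ℤ => Set.Ioc ((k : ℝ) * τ) ((k + 1) * τ)) y ξ) : ℝ)
      * τ - m| ≤ 2 * τ := by
  have hn' : (0 : ℝ) < n := by exact_mod_cast hn
  set bins : ℤ → Set ℝ := fun k : ℤ => Set.Ioc ((k : ℝ) * τ) ((k + 1) * τ) with hbins
  set p := stabilityHistogram ε δ bins y ξ with hp
  have hκ : ∀ y k, y ∈ bins k ↔ binIndex τ y = k := mem_Ioc_iff_binIndex hτ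
  have hnoise : ∀ k, binFraction y (bins k) ≠ 0 → |2 / (ε * n) * ξ k| ≤ 1 / 60 := by
    intro k hk
    rw [Ne, binFraction_eq_zero_iff] at hk
    push Not at hk
    obtain ⟨i, hi⟩ := hk
    rw [hκ] at hi
    exact hi ▸ hξ i
  obtain ⟨k₁, hk₁⟩ := exists_binFraction_ge hn hτ hout
  have hk₁0 : binFraction y (bins k₁) ≠ 0 := by
    intro h0
    change 4 / 15 ≤ binFraction y (bins k₁) at hk₁
    linarith
  -- 4/15 - 1/60 = 1/4, which exceeds the bound 1/5 on the threshold, so this bin is released.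
  have hpk₁ : 1 / 4 ≤ p k₁ := by
    have h1 := abs_le.1 (hnoise k₁ hk₁0)
    change 4 / 15 ≤ binFraction y (bins k₁) at hk₁
    have h2 : ¬ binFraction y (bins k₁) + 2 / (ε * n) * ξ k₁ <
        2 * Real.log (2 / δ) / (ε * n) + 1 / n := by linarith
    simp only [hp, stabilityHistogram, hk₁0, h2, if_false]
    linarith
  have hzero : ∀ k, binFraction y (bins k) = 0 → p k = 0 := by
    intro k hk
    simp [hp, stabilityHistogram, hk]
  -- Only finitely many bins are occupied, and empty bins have value 0 < p k₁; hence a maximum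
  -- exists and `maxBin` does not use its default.
  have hex : ∃ k, ∀ m, p m ≤ p k := by
    have hmem : ∀ k, binFraction y (bins k) ≠ 0 →
        k ∈ Finset.univ.image fun i => binIndex τ (y i) := by
      intro k hk
      rw [Ne, binFraction_eq_zero_iff] at hk
      push Not at hk
      obtain ⟨i, hi⟩ := hk
      exact Finset.mem_image.2 ⟨i, Finset.mem_univ _, (hκ _ _).1 hi⟩
    obtain ⟨k, _, hk⟩ := Finset.exists_max_image _ p ⟨k₁, hmem k₁ hk₁0⟩
    refine ⟨k, fun m => ?_⟩
    by_cases hm : binFraction y (bins m) = 0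
    · rw [hzero m hm]
      linarith [hk k₁ (hmem k₁ hk₁0)]
    · exact hk m (hmem m hm)
  have hmax := le_maxBin hex
  set k := maxBin p with hk
  have hpk : 1 / 4 ≤ p k := hpk₁.trans (hmax k₁)
  have hk0 : binFraction y (bins k) ≠ 0 := by
    intro h0
    rw [hzero k h0] at hpk
    norm_num at hpk
  -- The winning value is positive, so it is the noisy fraction, and 1/4 - 1/60 > 1/5 exceeds the
  -- fraction of outliers.
  have hfrac : 1 / 5 < binFraction y (bins k) := by
    have h1 := abs_le.1 (hnoise k hk0)
    have h2 : p k ≤ max 0 (binFraction y (bins k) + 2 / (ε * n) * ξ k) := by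
      simp only [hp, stabilityHistogram, hk0, if_false]
      split_ifs
      · exact le_max_left _ _
      · exact le_max_right _ _
    rcases le_max_iff.1 h2 with h3 | h3 <;> linarith
  obtain ⟨i, hi, hiτ⟩ : ∃ i, y i ∈ bins k ∧ |y i - m| < τ := by
    by_contra! hcon
    have h1 := binFraction_le_of_no_inlier hcon
    have h2 : (Set.ncard {i | τ ≤ |y i - m|} : ℝ) / n ≤ 1 / 5 := by
      rw [div_le_iff₀ hn']
      linarith
    linarith
  -- The left end point is within τ of the inlier, which is within τ of m.
  rw [abs_lt] at hiτ
  obtain ⟨h1, h2⟩ := hi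
  rw [abs_le]
  constructor <;> nlinarith

/-! ### Utility -/

theorem map_privateMean_eq_sphericalGaussian {d B : ℕ} {ε δ ζ K a Λ : ℝ}
    {g : Fin B → Fin d → ℝ} {ξ : Fin d → ℤ → ℝ} (h : truncated ε δ ζ K a Λ g ξ = g) :
    (stdGaussianNoise d).map (fun z => privateMean ε δ ζ K a Λ g (ξ, z)) =
      sphericalGaussian (empiricalMean g) (noiseScale d B ε δ ζ K a Λ) := by
  set s := noiseScale d B ε δ ζ K a Λ with hs
  have e : (fun z => privateMean ε δ ζ K a Λ g (ξ, z)) =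
      fun (z : Fin d → ℝ) j => empiricalMean g j + s * z j := by
    funext z j
    simp only [privateMean, h, ← hs]
  have hj : ∀ j, (gaussianReal 0 1).map (fun x => empiricalMean g j + s * x) =
      gaussianReal (empiricalMean g j) (Real.toNNReal (s ^ 2)) := by
    intro j
    have : (fun x => empiricalMean g j + s * x) =
        (fun x => empiricalMean g j + x) ∘ fun x => s * x := rfl
    rw [this, ← Measure.map_map (by fun_prop) (by fun_prop), gaussianReal_map_const_mul,
      gaussianReal_map_const_add, mul_zero, zero_add, mul_one]
    congr 1
    ext
    simp [sq_nonneg]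
  have hp : ∀ j, IsProbabilityMeasure
      ((gaussianReal 0 1).map (fun x => empiricalMean g j + s * x)) :=
    fun j => Measure.isProbabilityMeasure_map (by fun_prop)
  rw [e, stdGaussianNoise, Measure.pi_map_pi (μ := fun _ : Fin d => gaussianReal 0 1)
    (f := fun j x => empiricalMean g j + s * x) (fun j => by fun_prop), sphericalGaussian]
  simp_rw [hj]

theorem pi_exists_le {Ω : Type*} [MeasurableSpace Ω] (μ : Measure Ω) [IsProbabilityMeasure μ]
    {B : ℕ} {A : Set Ω} (hA : MeasurableSet A) {c : ℝ} (h : μ A ≤ ENNReal.ofReal c) :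
    (Measure.pi fun _ : Fin B => μ) {ω | ∃ i, ω i ∈ A} ≤ ENNReal.ofReal (B * c) := by
  rw [Set.ofPred_exists]
  refine (measure_iUnion_le _).trans ?_
  have hi : ∀ i : Fin B, (Measure.pi fun _ : Fin B => μ) {ω | ω i ∈ A} = μ A := by
    intro i
    have := (measurePreserving_eval (fun _ : Fin B => μ) i).measure_preimage hA.nullMeasurableSet
    exact this
  simp_rw [hi]
  rw [tsum_fintype, Finset.sum_const, Finset.card_univ, Fintype.card_fin, nsmul_eq_mul,
    ENNReal.ofReal_mul (by positivity), ENNReal.ofReal_natCast]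
  gcongr

/-- A Chernoff bound for the number of occurrences of an event of probability at most `2/25`. -/
theorem pi_ncard_gt_le {Ω : Type*} [MeasurableSpace Ω] (μ : Measure Ω) [IsProbabilityMeasure μ]
    {B : ℕ} {A : Set Ω} (hA : MeasurableSet A) (h : μ A ≤ ENNReal.ofReal (2 / 25)) :
    (Measure.pi fun _ : Fin B => μ) {ω | (B : ℝ) / 5 < Set.ncard {i | ω i ∈ A}} ≤
      ENNReal.ofReal (Real.exp (-(0.06 * B))) := by
  classical
  set P := Measure.pi fun _ : Fin B => μ
  -- f is the exponential of the indicator of `A`, so the product over the sample is exp of the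
  -- count. Its mean is at most 1 + (e-1)·2/25 ≤ e^{0.14}, and Markov at level e^{B/5} leaves 0.14 -
  -- 0.2 = -0.06.
  set f : Ω → ℝ≥0∞ := fun x => 1 + A.indicator (fun _ => ENNReal.ofReal (Real.exp 1 - 1)) x with hf
  have he : 0 ≤ Real.exp 1 - 1 := by linarith [Real.add_one_le_exp (1 : ℝ)]
  have hfm : Measurable f := (measurable_const.indicator hA).const_add 1
  have hfint : ∫⁻ x, f x ∂μ ≤ ENNReal.ofReal (Real.exp 0.14) := by
    rw [hf, lintegral_add_left measurable_const, lintegral_indicator_const hA, lintegral_const,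
      measure_univ, one_mul]
    calc _ ≤ 1 + ENNReal.ofReal (Real.exp 1 - 1) * ENNReal.ofReal (2 / 25) := by gcongr
      _ = ENNReal.ofReal (1 + (Real.exp 1 - 1) * (2 / 25)) := by
        rw [← ENNReal.ofReal_mul he, ENNReal.ofReal_add zero_le_one (by positivity),
          ENNReal.ofReal_one]
      _ ≤ _ := by
        refine ENNReal.ofReal_le_ofReal ?_
        linarith [Real.exp_one_lt_d9, Real.add_one_le_exp (0.14 : ℝ)]
  have hprod : ∫⁻ ω, ∏ i, f (ω i) ∂P ≤ ENNReal.ofReal (Real.exp (0.14 * B)) := by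
    have hind := iIndepFun_pi (μ := fun _ : Fin B => μ) (X := fun _ => f)
      fun _ => hfm.aemeasurable
    rw [lintegral_prod_eq_prod_lintegral_of_indepFun Finset.univ (fun i (ω : Fin B → Ω) => f (ω i))
      hind (fun i => hfm.comp (measurable_pi_apply i))]
    have hi : ∀ i : Fin B, ∫⁻ ω, f (ω i) ∂P = ∫⁻ x, f x ∂μ := by
      intro i
      exact (measurePreserving_eval (fun _ : Fin B => μ) i).lintegral_comp hfm
    rw [Finset.prod_congr rfl fun i _ => hi i, Finset.prod_const, Finset.card_univ,
      Fintype.card_fin, mul_comm, Real.exp_nat_mul,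
      ENNReal.ofReal_pow (Real.exp_pos _).le]
    gcongr
  have hval : ∀ ω : Fin B → Ω, ∏ i, f (ω i) =
      ENNReal.ofReal (Real.exp (Set.ncard {i | ω i ∈ A})) := by
    intro ω
    have h1 : ∀ i, f (ω i) = if ω i ∈ A then ENNReal.ofReal (Real.exp 1) else 1 := by
      intro i
      by_cases hi : ω i ∈ A
      · simp only [hf, Set.indicator_of_mem hi, hi, if_true]
        rw [← ENNReal.ofReal_one, ← ENNReal.ofReal_add zero_le_one he]
        congr 1
        ring
      · simp [hf, hi]
    simp_rw [h1]
    rw [Finset.prod_ite, Finset.prod_const_one, mul_one, Finset.prod_const,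
      ← ENNReal.ofReal_pow (Real.exp_pos _).le, ← Real.exp_nat_mul, mul_one,
      Set.ncard_eq_toFinset_card']
    congr 4
    ext i
    simp
  have hsub : {ω : Fin B → Ω | (B : ℝ) / 5 < Set.ncard {i | ω i ∈ A}} ⊆
      {ω | ENNReal.ofReal (Real.exp (B / 5)) ≤ ∏ i, f (ω i)} := by
    intro ω hω
    show _ ≤ ∏ i, f (ω i)
    rw [hval]
    exact ENNReal.ofReal_le_ofReal (Real.exp_le_exp.2 (le_of_lt hω))
  have hm : Measurable fun ω : Fin B → Ω => ∏ i, f (ω i) :=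
    Finset.measurable_prod _ fun i _ => hfm.comp (measurable_pi_apply i)
  refine (measure_mono hsub).trans ((meas_ge_le_lintegral_div hm.aemeasurable
    (by simpa using Real.exp_pos _) ENNReal.ofReal_ne_top).trans ?_)
  calc _ ≤ ENNReal.ofReal (Real.exp (0.14 * B)) / ENNReal.ofReal (Real.exp (B / 5)) := by gcongr
    _ = _ := by
      rw [← ENNReal.ofReal_div_of_pos (Real.exp_pos _), ← Real.exp_sub]
      congr 2
      ring

theorem measurable_binIndex (τ : ℝ) : Measurable (binIndex τ) := by
  unfold binIndex
  have : Measurable fun y : ℝ => ⌈y / τ⌉ := Int.measurable_ceil.comp (by fun_prop)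
  exact (measurable_of_countable (fun k : ℤ => k - 1)).comp this

/-- The noise in the bins occupied by the points is small with high probability. -/
theorem prod_histNoise_occupied_le {Ω : Type*} [MeasurableSpace Ω] (P : Measure Ω)
    [IsProbabilityMeasure P] {d B : ℕ} {k : Fin B → Fin d → Ω → ℤ}
    (hk : ∀ i j, Measurable (k i j)) (t : ℝ) :
    (P.prod (histNoise d)) {ω | ∃ i j, t ≤ |ω.2 j (k i j ω.1)|} ≤
      ENNReal.ofReal (B * (d * Real.exp (-t))) := by
  have hone : ∀ i j, (P.prod (histNoise d)) {ω | t ≤ |ω.2 j (k i j ω.1)|} ≤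
      ENNReal.ofReal (Real.exp (-t)) := by
    intro i j
    have hm : Measurable fun ω : Ω × (Fin d → ℤ → ℝ) => ω.2 j (k i j ω.1) := by
      have h1 : Measurable fun p : ℤ × (Fin d → ℤ → ℝ) => p.2 j p.1 :=
        measurable_from_prod_countable_right fun l => by
          show Measurable fun ξ : Fin d → ℤ → ℝ => ξ j l
          fun_prop
      exact h1.comp (((hk i j).comp measurable_fst).prodMk measurable_snd)
    have hS : MeasurableSet {ω : Ω × (Fin d → ℤ → ℝ) | t ≤ |ω.2 j (k i j ω.1)|} :=
      measurableSet_le measurable_const hm.abs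
    -- The bin is random but independent of the noise: for each fixed sample it is one fixed bin,
    -- and the Laplace tail applies. Thus the union bound runs over Bd pairs and not over all bins.
    rw [Measure.prod_apply hS]
    calc _ ≤ ∫⁻ _, ENNReal.ofReal (Real.exp (-t)) ∂P := by
          refine lintegral_mono fun x => ?_
          have := histNoise_eval_mem j (k i j x) (A := {y | t ≤ |y|})
            (measurableSet_le measurable_const (by fun_prop))
          exact this.le.trans (stdLaplace_abs_ge_le t)
      _ = _ := by simp
  have hset : {ω : Ω × (Fin d → ℤ → ℝ) | ∃ i j, t ≤ |ω.2 j (k i j ω.1)|} =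
      ⋃ i, ⋃ j, {ω | t ≤ |ω.2 j (k i j ω.1)|} := by
    ext ω; simp
  rw [hset]
  calc _ ≤ ∑' i : Fin B, ∑' j : Fin d, ENNReal.ofReal (Real.exp (-t)) :=
        (measure_iUnion_le _).trans (ENNReal.tsum_le_tsum fun i =>
          (measure_iUnion_le _).trans (ENNReal.tsum_le_tsum fun j => hone i j))
    _ = _ := by
        simp only [tsum_fintype, Finset.sum_const, Finset.card_univ, Fintype.card_fin,
          nsmul_eq_mul]
        rw [ENNReal.ofReal_mul (by positivity), ENNReal.ofReal_mul (by positivity),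
          ENNReal.ofReal_natCast, ENNReal.ofReal_natCast]

/-! ### Numerical constants and the truncation box -/

/-- If the box is large enough relative to the scale of the points, nothing is truncated. -/
theorem box_radius_le {a ℓ σ ρ : ℝ} (ha : 0 < a) (hℓ : Real.log 25 * 4 ^ (1 / a) + 8 * a ≤ ℓ)
    (hρ : 0 ≤ ρ) (hσ : σ ≤ 2 ^ (1 / 4 : ℝ) * ρ) :
    2 * (2 ^ (1 / 4 : ℝ) * ρ * Real.log 25 ^ a) + σ * (ℓ + Real.log 8) ^ a ≤ 3 * ρ * ℓ ^ a := by
  have h25 : 0 < Real.log 25 := Real.log_pos (by norm_num)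
  have h8 : 0 < Real.log 8 := Real.log_pos (by norm_num)
  have h4 : (0 : ℝ) < 4 ^ (1 / a) := by positivity
  have hℓ1 : Real.log 25 * 4 ^ (1 / a) ≤ ℓ := by linarith
  have hℓ2 : 8 * a ≤ ℓ := by nlinarith
  have hℓ0 : 0 < ℓ := by linarith
  have hℓa : 0 < ℓ ^ a := Real.rpow_pos_of_pos hℓ0 a
  have h2 : (2 : ℝ) ^ (1 / 4 : ℝ) ≤ 1.2 := by
    have e : (1.2 : ℝ) = (1.2 ^ (4 : ℝ)) ^ (1 / 4 : ℝ) := by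
      rw [← Real.rpow_mul (by norm_num)]; norm_num
    rw [e]
    refine Real.rpow_le_rpow (by norm_num) ?_ (by norm_num)
    norm_num
  -- The term log 25 · 4^{1/a} in the lower bound for ℓ serves this estimate; the term 8a serves
  -- `hB`, through a log 8/ℓ ≤ 0.3. The total is then at most (2·1.2/4 + 1.2·1.5) ρℓ^a = 2.4 ρℓ^a.
  have hA : Real.log 25 ^ a ≤ ℓ ^ a / 4 := by
    rw [le_div_iff₀ (by norm_num)]
    calc Real.log 25 ^ a * 4 = (Real.log 25 * 4 ^ (1 / a)) ^ a := by
          rw [Real.mul_rpow h25.le h4.le, ← Real.rpow_mul (by norm_num), one_div_mul_cancel ha.ne',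
            Real.rpow_one]
      _ ≤ _ := by gcongr
  have hlog8 : Real.log 8 ≤ 2.1 := by
    have e : Real.log 8 = 3 * Real.log 2 := by
      rw [show (8 : ℝ) = 2 ^ 3 by norm_num, Real.log_pow]; norm_num
    rw [e]
    linarith [Real.log_two_lt_d9]
  have hB : (ℓ + Real.log 8) ^ a ≤ 1.5 * ℓ ^ a := by
    have h1 : ℓ + Real.log 8 ≤ ℓ * Real.exp (Real.log 8 / ℓ) := by
      have := Real.add_one_le_exp (Real.log 8 / ℓ)
      calc ℓ + Real.log 8 = ℓ * (Real.log 8 / ℓ + 1) := by field_simp; ring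
        _ ≤ _ := by gcongr
    have h3 : Real.exp (Real.log 8 / ℓ * a) ≤ 1.5 := by
      have h5 : Real.log 8 / ℓ * a ≤ 0.3 := by
        rw [div_mul_eq_mul_div, div_le_iff₀ hℓ0]
        nlinarith
      have h6 := Real.add_one_le_exp (-0.3 : ℝ)
      calc _ ≤ Real.exp 0.3 := Real.exp_le_exp.2 h5
        _ = (Real.exp (-0.3))⁻¹ := by rw [← Real.exp_neg]; norm_num
        _ ≤ (0.7 : ℝ)⁻¹ := by gcongr; linarith
        _ ≤ 1.5 := by norm_num
    calc _ ≤ (ℓ * Real.exp (Real.log 8 / ℓ)) ^ a := by gcongr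
      _ = ℓ ^ a * Real.exp (Real.log 8 / ℓ * a) := by
          rw [Real.mul_rpow hℓ0.le (Real.exp_pos _).le, ← Real.exp_mul]
      _ ≤ ℓ ^ a * 1.5 := by gcongr
      _ = _ := mul_comm _ _
  have hρℓ : 0 ≤ ρ * ℓ ^ a := by positivity
  have hσ' : σ ≤ 1.2 * ρ := hσ.trans (by gcongr)
  calc _ ≤ 2 * (1.2 * ρ * (ℓ ^ a / 4)) + 1.2 * ρ * (1.5 * ℓ ^ a) := by gcongr
    _ ≤ _ := by nlinarith

set_option maxHeartbeats 800000 in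
/-- The consequences of the lower bound on the batch size. -/
theorem batch_size_bounds {d B : ℕ} {ε δ ζ C : ℝ} (hd : 0 < d) (hε : 0 < ε) (hε1 : ε < 0.9)
    (hδ : 0 < δ) (hζ : 0 < ζ) (hζ1 : ζ < 1) (hB : 2 ≤ B) (hδB : δ ≤ 1 / (B : ℝ)) (hC : 3600 ≤ C)
    (h : C * (√(d * Real.log (1 / δ)) / ε * Real.log (d / (ζ * δ))) ≤ (B : ℝ)) :
    C / 2 ≤ B ∧ d * Real.exp (-(0.06 * B)) ≤ ζ / 4 ∧
    2 / (ε / (4 * √(2 * d * Real.log (4 / δ))) * B) * Real.log (4 * B * d / ζ) ≤ 1 / 60 ∧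
    2 * Real.log (2 / (δ / (4 * d))) / (ε / (4 * √(2 * d * Real.log (4 / δ))) * B) + 1 / B ≤
      1 / 5 := by
  have hd1 : (1 : ℝ) ≤ d := by exact_mod_cast hd
  have hd' : (0 : ℝ) < d := by linarith
  have hB2 : (2 : ℝ) ≤ B := by exact_mod_cast hB
  have hB' : (0 : ℝ) < B := by linarith
  -- The assumption δ ≤ 1/B lets log(1/δ) absorb log B, and B ≥ 2 bounds it below by log 2, so it
  -- also absorbs numerical constants.
  have hBδ : B ≤ 1 / δ := by rwa [le_div_iff₀ hδ, mul_comm, ← le_div_iff₀ hB']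
  have hl2 := Real.log_two_gt_d9
  set D := Real.log (1 / δ) with hD
  have hD0 : Real.log 2 ≤ D := Real.log_le_log (by norm_num) (hB2.trans hBδ)
  set L := Real.log (d / (ζ * δ)) with hL
  have hLD : D ≤ L := by
    refine Real.log_le_log (by positivity) ?_
    gcongr
    nlinarith
  set W := √(d * D) / ε with hW
  have hsq : 0.8 ≤ √(d * D) := by
    refine Real.le_sqrt_of_sq_le ?_
    nlinarith
  have hW0 : 0.8 ≤ W := by
    rw [hW, le_div_iff₀ hε]
    nlinarith
  have hlog4 : Real.log 4 = 2 * Real.log 2 := by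
    rw [show (4 : ℝ) = 2 ^ 2 by norm_num, Real.log_pow]; norm_num
  have hlog8 : Real.log 8 = 3 * Real.log 2 := by
    rw [show (8 : ℝ) = 2 ^ 3 by norm_num, Real.log_pow]; norm_num
  have hWL : 0.8 * 0.69 ≤ W * L := by
    have : (0.69 : ℝ) ≤ L := by linarith
    gcongr
  have hCB : 3600 * (W * L) ≤ B := (mul_le_mul_of_nonneg_right hC (by linarith)).trans h
  -- The left side is 8√(2d log(4/δ))/ε, and 8 · 2.5 = 20.
  have hε₀ : 2 / (ε / (4 * √(2 * d * Real.log (4 / δ)))) ≤ 20 * W := by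
    have h1 : Real.log (4 / δ) ≤ 3 * D := by
      rw [show (4 : ℝ) / δ = 4 * (1 / δ) by ring, Real.log_mul (by norm_num) (by positivity)]
      linarith
    have h2 : √(2 * d * Real.log (4 / δ)) ≤ 2.5 * √(d * D) := by
      refine Real.sqrt_le_iff.2 ⟨by positivity, ?_⟩
      rw [mul_pow, Real.sq_sqrt (by nlinarith)]
      nlinarith
    rw [div_div_eq_mul_div, hW, ← mul_div_assoc]
    exact div_le_div_of_nonneg_right (by linarith) hε.le
  have hdiv : ∀ x : ℝ, 0 ≤ x → x ≤ 4 * L →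
      2 / (ε / (4 * √(2 * d * Real.log (4 / δ))) * B) * x ≤ 20 * W * x / B := by
    intro x hx _
    rw [← div_div, div_mul_eq_mul_div]
    gcongr
  refine ⟨?_, ?_, ?_, ?_⟩
  · have : C * (0.8 * 0.69) ≤ B := (mul_le_mul_of_nonneg_left hWL (by linarith)).trans h
    linarith
  · have h1 : Real.log (4 * d / ζ) ≤ 3 * L := by
      have h2 : Real.log (4 * d / ζ) = Real.log 4 + Real.log (d / ζ) := by
        rw [mul_div_assoc, Real.log_mul (by norm_num) (by positivity)]
      have h3 : Real.log (d / ζ) ≤ L := by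
        refine Real.log_le_log (by positivity) ?_
        gcongr
        have : δ ≤ 1 := hδB.trans (by rw [div_le_one hB']; linarith)
        nlinarith
      linarith
    have h4 : 3 * L ≤ 0.06 * B := by nlinarith
    have h5 : Real.exp (-(0.06 * B)) ≤ Real.exp (-Real.log (4 * d / ζ)) :=
      Real.exp_le_exp.2 (by linarith)
    rw [Real.exp_neg (Real.log _), Real.exp_log (by positivity), inv_div] at h5
    calc _ ≤ d * (ζ / (4 * d)) := by gcongr
      _ = _ := by field_simp
  · have h1 : Real.log (4 * B * d / ζ) ≤ 3 * L := by
      have h2 : Real.log (4 * B * d / ζ) = Real.log 4 + Real.log (B * d / ζ) := by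
        rw [mul_assoc, mul_div_assoc, Real.log_mul (by norm_num) (by positivity)]
      have h3 : Real.log (B * d / ζ) ≤ L := by
        refine Real.log_le_log (by positivity) ?_
        calc (B : ℝ) * d / ζ ≤ 1 / δ * d / ζ := by gcongr
          _ = _ := by field_simp
      linarith
    have h0 : 0 ≤ Real.log (4 * B * d / ζ) := by
      refine Real.log_nonneg ?_
      rw [le_div_iff₀ hζ]
      nlinarith
    refine (hdiv _ h0 (by linarith)).trans ?_
    rw [div_le_iff₀ hB']
    -- Requiring 20 W · 3L ≤ B/60 is what determines the constant 3600.
    have : 20 * W * Real.log (4 * B * d / ζ) ≤ 20 * W * (3 * L) := by gcongr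
    linarith
  · have h1 : Real.log (2 / (δ / (4 * d))) ≤ 4 * L := by
      have h2 : Real.log (2 / (δ / (4 * d))) = Real.log 8 + Real.log (d / δ) := by
        rw [← Real.log_mul (by norm_num) (by positivity)]
        congr 1
        field_simp
        norm_num
      have h3 : Real.log (d / δ) ≤ L := by
        refine Real.log_le_log (by positivity) ?_
        gcongr
        nlinarith
      linarith
    have h0 : 0 ≤ Real.log (2 / (δ / (4 * d))) := by
      refine Real.log_nonneg ?_
      have : δ ≤ 1 := hδB.trans (by rw [div_le_one hB']; linarith)
      rw [le_div_iff₀ (by positivity), one_mul, div_le_iff₀ (by positivity)]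
      nlinarith
    have h5 := hdiv _ h0 h1
    have h6 : 20 * W * Real.log (2 / (δ / (4 * d))) / B ≤ 0.1 := by
      rw [div_le_iff₀ hB']
      have : 20 * W * Real.log (2 / (δ / (4 * d))) ≤ 20 * W * (4 * L) := by gcongr
      linarith
    have h7 : 1 / (B : ℝ) ≤ 0.1 := by
      rw [div_le_iff₀ hB']
      linarith
    rw [div_mul_eq_mul_div] at h5
    calc _ ≤ (0.1 : ℝ) + 0.1 := add_le_add (h5.trans h6) h7
      _ = _ := by norm_num

/-- Without outliers and large noise, all points lie in the truncation box. -/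
theorem abs_sub_boxCenter_le {d B : ℕ} {ε δ ζ K a Λ σ : ℝ} (hd : 0 < d) (hB : 0 < B)
    (hε : 0 < ε) (hδ : 0 < δ) (hδ1 : δ < 1) (hζ : 0 < ζ) (hK : 0 < K) (ha : 0 < a) (hΛ : 0 < Λ)
    (hσ : σ ≤ 2 ^ (1 / 4 : ℝ) * (K * √Λ))
    (hℓ : Real.log 25 * 4 ^ (1 / a) + 8 * a ≤ Real.log (B * d / ζ))
    (hnoise : 2 / (ε / (4 * √(2 * d * Real.log (4 / δ))) * B) * Real.log (4 * B * d / ζ) ≤ 1 / 60)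
    (hthr : 2 * Real.log (2 / (δ / (4 * d))) / (ε / (4 * √(2 * d * Real.log (4 / δ))) * B) +
      1 / B ≤ 1 / 5) {g : Fin B → Fin d → ℝ} {m : Fin d → ℝ} {ξ : Fin d → ℤ → ℝ} {j : Fin d}
    (hout : (Set.ncard {i | binWidth K a Λ ≤ |g i j - m j|} : ℝ) ≤ B / 5)
    (hfar : ∀ i, |g i j - m j| ≤ σ * Real.log (8 * B * d / ζ) ^ a)
    (hξ : ∀ i, |ξ j (binIndex (binWidth K a Λ) (g i j))| ≤ Real.log (4 * B * d / ζ)) (i : Fin B) :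
    |g i j - boxCenter ε δ K a Λ g ξ j| ≤ 3 * K * √Λ * Real.log (B * d / ζ) ^ a := by
  have hd' : (0 : ℝ) < d := by exact_mod_cast hd
  have hB' : (0 : ℝ) < B := by exact_mod_cast hB
  have hM : 0 < Real.log (4 / δ) := Real.log_pos (by rw [one_lt_div hδ]; linarith)
  have hε₀ : 0 < ε / (4 * √(2 * d * Real.log (4 / δ))) := by positivity
  set ε₀ := ε / (4 * √(2 * d * Real.log (4 / δ))) with hε₀def
  have hτ : 0 < binWidth K a Λ := binWidth_pos hK hΛ
  have h1 := abs_maxBin_sub_le (y := fun i => g i j) (ε := ε₀) (δ := δ / (4 * d)) (ξ := ξ j)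
    hB hτ hout (fun i => by
      rw [abs_mul, abs_of_pos (by positivity : 0 < 2 / (ε₀ * B))]
      refine le_trans ?_ hnoise
      gcongr
      exact hξ i) hthr
  change |boxCenter ε δ K a Λ g ξ j - m j| ≤ 2 * binWidth K a Λ at h1
  have h2 := box_radius_le ha hℓ (by positivity : 0 ≤ K * √Λ) hσ
  have hlog : Real.log (8 * B * d / ζ) = Real.log (B * d / ζ) + Real.log 8 := by
    rw [mul_assoc, mul_div_assoc, Real.log_mul (by norm_num) (by positivity), add_comm]
  have h3 := hfar i
  rw [hlog] at h3
  have h4 : |g i j - boxCenter ε δ K a Λ g ξ j| ≤ |g i j - m j| +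
      |boxCenter ε δ K a Λ g ξ j - m j| := by
    rw [abs_sub_comm (boxCenter ε δ K a Λ g ξ j)]
    exact abs_sub_le _ _ _
  have h5 : 2 * binWidth K a Λ = 2 * (2 ^ (1 / 4 : ℝ) * (K * √Λ) * Real.log 25 ^ a) := by
    rw [binWidth]; ring
  calc _ ≤ σ * (Real.log (B * d / ζ) + Real.log 8) ^ a + 2 * binWidth K a Λ := by linarith
    _ ≤ 3 * (K * √Λ) * Real.log (B * d / ζ) ^ a := by rw [h5]; linarith
    _ = _ := by ring

theorem truncated_eq_self {d B : ℕ} {ε δ ζ K a Λ : ℝ} {g : Fin B → Fin d → ℝ}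
    {ξ : Fin d → ℤ → ℝ}
    (h : ∀ i j, |g i j - boxCenter ε δ K a Λ g ξ j| ≤ truncRadius d B ζ K a Λ) :
    truncated ε δ ζ K a Λ g ξ = g := by
  funext i j
  have := abs_le.1 (h i j)
  rw [truncated, min_eq_right (by linarith), max_eq_right (by linarith)]

theorem prod_exists_fst_mem_le {Ω Ξ : Type*} [MeasurableSpace Ω] [MeasurableSpace Ξ]
    (P : Measure Ω) (Q : Measure Ξ) [SFinite P] [IsProbabilityMeasure Q] {d : ℕ}
    (E : Fin d → Set Ω) {c : ℝ} (hE : ∀ j, P (E j) ≤ ENNReal.ofReal c) :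
    (P.prod Q) {ω | ∃ j, ω.1 ∈ E j} ≤ ENNReal.ofReal (d * c) := by
  have e : {ω : Ω × Ξ | ∃ j, ω.1 ∈ E j} = ⋃ j, E j ×ˢ Set.univ := by
    ext ω; simp
  rw [e]
  calc _ ≤ ∑' _j : Fin d, ENNReal.ofReal c :=
        (measure_iUnion_le _).trans (ENNReal.tsum_le_tsum fun j => by
          rw [Measure.prod_prod, measure_univ, mul_one]
          exact hE j)
    _ = _ := by
        rw [tsum_fintype, Finset.sum_const, Finset.card_univ, Fintype.card_fin, nsmul_eq_mul,
          ENNReal.ofReal_mul (Nat.cast_nonneg d), ENNReal.ofReal_natCast]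

/-! ### The union bound and the main theorem -/

/-- The probability that there are outliers or large noise values. -/
theorem prod_bad_event_le {Ω : Type*} [MeasurableSpace Ω] (μ : Measure Ω)
    [IsProbabilityMeasure μ] {d B : ℕ} (hd : 0 < d) (hB : 0 < B) {ζ τ R : ℝ} (hζ : 0 < ζ)
    {X : Fin d → Ω → ℝ} (hX : ∀ j, Measurable (X j)) (m : Fin d → ℝ)
    (hτ : ∀ j, μ {A | τ ≤ |X j A - m j|} ≤ ENNReal.ofReal (2 / 25))
    (hR : ∀ j, μ {A | R ≤ |X j A - m j|} ≤ ENNReal.ofReal (2 / (8 * B * d / ζ)))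
    (hexp : d * Real.exp (-(0.06 * B)) ≤ ζ / 4) :
    ((Measure.pi fun _ : Fin B => μ).prod (histNoise d))
      ({ω | ∃ j, (B : ℝ) / 5 < Set.ncard {i | τ ≤ |X j (ω.1 i) - m j|}} ∪
       ({ω | ∃ j i, R ≤ |X j (ω.1 i) - m j|} ∪
        {ω | ∃ i j, Real.log (4 * B * d / ζ) ≤ |ω.2 j (binIndex τ (X j (ω.1 i)))|})) ≤
      ENNReal.ofReal ζ := by
  have hd' : (0 : ℝ) < d := by exact_mod_cast hd
  have hB' : (0 : ℝ) < B := by exact_mod_cast hB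
  have hmeas : ∀ (t : ℝ) j, MeasurableSet {A | t ≤ |X j A - m j|} := fun t j =>
    measurableSet_le measurable_const ((hX j).sub_const _).abs
  have h1 := prod_exists_fst_mem_le (Measure.pi fun _ : Fin B => μ) (histNoise d) _
    fun j => pi_ncard_gt_le (B := B) μ (hmeas τ j) (hτ j)
  have h2 := prod_exists_fst_mem_le (Measure.pi fun _ : Fin B => μ) (histNoise d) _
    fun j => pi_exists_le (B := B) μ (hmeas R j) (hR j)
  simp only [Set.mem_ofPred_eq] at h1 h2
  have h3 := prod_histNoise_occupied_le (Measure.pi fun _ : Fin B => μ)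
    (k := fun (i : Fin B) (j : Fin d) (ω : Fin B → Ω) => binIndex τ (X j (ω i)))
    (fun i j => (measurable_binIndex τ).comp ((hX j).comp (measurable_pi_apply i)))
    (Real.log (4 * B * d / ζ))
  refine (measure_union_le _ _).trans ((add_le_add h1 ((measure_union_le _ _).trans
    (add_le_add h2 h3))).trans ?_)
  rw [← ENNReal.ofReal_add (by positivity) (by positivity),
    ← ENNReal.ofReal_add (by positivity) (by positivity)]
  refine ENNReal.ofReal_le_ofReal ?_
  have e1 : (d : ℝ) * (B * (2 / (8 * B * d / ζ))) = ζ / 4 := by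
    field_simp
    norm_num
  have e2 : (B : ℝ) * (d * Real.exp (-Real.log (4 * B * d / ζ))) = ζ / 4 := by
    rw [Real.exp_neg, Real.exp_log (by positivity)]
    field_simp
  rw [e1, e2]
  linarith

/-- Outliers, far points and large noise each have probability at most ζ/4. Off these events the
deterministic bound `abs_sub_boxCenter_le` applies in every coordinate. -/
theorem privateMean_utility {a C : ℝ} (ha : 0 < a) (hC : 3600 ≤ C)
    (hCa : 2 * Real.exp (Real.log 25 * 4 ^ (1 / a) + 8 * a) ≤ C) (d B : ℕ) (ε δ ζ K Λ : ℝ)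
    (μ : Measure (Matrix (Fin d) (Fin d) ℝ)) (S : Matrix (Fin d) (Fin d) ℝ) (u : Fin d → ℝ)
    (hε : 0 < ε) (hε1 : ε < 0.9) (hδ : 0 < δ) (hδ1 : δ < 1) (hζ : 0 < ζ) (hζ1 : ζ < 1)
    (hM : GradientModel μ S K a) (hΛ : 0 < Λ)
    (hV1 : topEigenvalue S ^ 2 * spectralNorm₂ (Hmat μ S u) / √2 ≤ Λ)
    (hV2 : Λ ≤ √2 * (topEigenvalue S ^ 2 * spectralNorm₂ (Hmat μ S u)))
    (hB2 : 2 ≤ B) (hδB : δ ≤ 1 / (B : ℝ))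
    (hCB : C * (√(d * Real.log (1 / δ)) / ε * Real.log (d / (ζ * δ))) ≤ (B : ℝ)) :
    ENNReal.ofReal (1 - ζ) ≤ ((Measure.pi fun _ : Fin B => μ).prod (histNoise d))
      {ω | ∀ i j, |(ω.1 i).mulVec u j -
        boxCenter ε δ K a Λ (fun i => (ω.1 i).mulVec u) ω.2 j| ≤ truncRadius d B ζ K a Λ} := by
  have hμ := hM.isProb
  have hK := hM.K_pos
  rcases Nat.eq_zero_or_pos d with rfl | hd
  · have : ∀ ω : (Fin B → Matrix (Fin 0) (Fin 0) ℝ) × (Fin 0 → ℤ → ℝ), ∀ i : Fin B,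
        ∀ j : Fin 0, |(ω.1 i).mulVec u j -
          boxCenter ε δ K a Λ (fun i => (ω.1 i).mulVec u) ω.2 j| ≤ truncRadius 0 B ζ K a Λ :=
      fun _ _ j => j.elim0
    simp only [this, implies_true, Set.ofPred_true, measure_univ]
    exact ENNReal.ofReal_le_one.2 (by linarith)
  have hB : 0 < B := by omega
  have hd' : (1 : ℝ) ≤ d := by exact_mod_cast hd
  have hB' : (2 : ℝ) ≤ B := by exact_mod_cast hB2
  obtain ⟨hb1, hb2, hb3, hb4⟩ := batch_size_bounds hd hε hε1 hδ hζ hζ1 hB2 hδB hC hCB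
  have h2 : 0 < √2 := Real.sqrt_pos.2 (by norm_num)
  set V := topEigenvalue S ^ 2 * spectralNorm₂ (Hmat μ S u) with hVdef
  have hV : 0 < V := by
    by_contra hcon
    nlinarith
  -- The factor 2^{1/4} in the bin width is √√2, the price of knowing V only up to the factor √2.
  have hσ : K * √V ≤ 2 ^ (1 / 4 : ℝ) * (K * √Λ) := by
    have h3 : √V ≤ 2 ^ (1 / 4 : ℝ) * √Λ := by
      rw [div_le_iff₀ h2] at hV1
      have e : (2 : ℝ) ^ (1 / 4 : ℝ) = √√2 := by
        rw [Real.sqrt_eq_rpow, Real.sqrt_eq_rpow, ← Real.rpow_mul (by norm_num)]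
        norm_num
      rw [e, ← Real.sqrt_mul h2.le, mul_comm (√2)]
      exact Real.sqrt_le_sqrt hV1
    calc _ ≤ K * (2 ^ (1 / 4 : ℝ) * √Λ) := by gcongr
      _ = _ := by ring
  -- This is where C must depend on a: Bd/ζ ≥ B ≥ C/2 has to exceed an exponential in a and 4^{1/a}.
  have hℓ : Real.log 25 * 4 ^ (1 / a) + 8 * a ≤ Real.log (B * d / ζ) := by
    rw [Real.le_log_iff_exp_le (by positivity)]
    have h3 : (B : ℝ) ≤ B * d / ζ := by
      rw [le_div_iff₀ hζ]
      nlinarith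
    linarith
  have hτσ : K * √V * Real.log 25 ^ a ≤ binWidth K a Λ := by
    have h25 : 0 < Real.log 25 := Real.log_pos (by norm_num)
    calc _ ≤ 2 ^ (1 / 4 : ℝ) * (K * √Λ) * Real.log 25 ^ a := by gcongr
      _ = _ := by rw [binWidth]; ring
  have hx : 1 < 8 * B * d / ζ := by
    rw [one_lt_div hζ]
    nlinarith
  have hbad := prod_bad_event_le μ hd hB hζ (fun j => measurable_matrix_mulVec u j)
    (fun j => S.mulVec u j) (τ := binWidth K a Λ)
    (fun j => (measure_mono fun A hA => hτσ.trans hA).trans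
      (hM.tail_le hV j (by norm_num : (1 : ℝ) < 25)))
    (fun j => hM.tail_le hV j hx) hb2
  set bad := {ω : (Fin B → Matrix (Fin d) (Fin d) ℝ) × (Fin d → ℤ → ℝ) |
      ∃ j, (B : ℝ) / 5 < Set.ncard {i | binWidth K a Λ ≤ |(ω.1 i).mulVec u j - S.mulVec u j|}} ∪
    ({ω | ∃ j i, K * √V * Real.log (8 * B * d / ζ) ^ a ≤
      |(ω.1 i).mulVec u j - S.mulVec u j|} ∪
     {ω | ∃ i j, Real.log (4 * B * d / ζ) ≤
      |ω.2 j (binIndex (binWidth K a Λ) ((ω.1 i).mulVec u j))|}) with hbaddef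
  set good := {ω : (Fin B → Matrix (Fin d) (Fin d) ℝ) × (Fin d → ℤ → ℝ) | ∀ i j,
    |(ω.1 i).mulVec u j - boxCenter ε δ K a Λ (fun i => (ω.1 i).mulVec u) ω.2 j| ≤
      truncRadius d B ζ K a Λ} with hgooddef
  have hsub : badᶜ ⊆ good := by
    intro ω hω
    simp only [hbaddef, Set.mem_compl_iff, Set.mem_union, Set.mem_ofPred_eq, not_or, not_exists,
      not_lt, not_le] at hω
    obtain ⟨hω1, hω2, hω3⟩ := hω
    intro i j
    exact abs_sub_boxCenter_le hd hB hε hδ hδ1 hζ hK ha hΛ hσ hℓ hb3 hb4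
      (g := fun i => (ω.1 i).mulVec u) (m := fun j => S.mulVec u j) (hω1 j)
      (fun i => (hω2 j i).le) (fun i => (hω3 i j).le) i
  -- Subadditivity on the good and bad sets bounds the good one from below without its
  -- measurability.
  have hone : 1 ≤ ((Measure.pi fun _ : Fin B => μ).prod (histNoise d)) good +
      ENNReal.ofReal ζ := by
    calc 1 = ((Measure.pi fun _ : Fin B => μ).prod (histNoise d)) Set.univ := measure_univ.symm
      _ ≤ ((Measure.pi fun _ : Fin B => μ).prod (histNoise d)) (good ∪ bad) := by
          refine measure_mono fun ω _ => ?_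
          by_cases h : ω ∈ bad
          · exact Or.inr h
          · exact Or.inl (hsub h)
      _ ≤ _ := (measure_union_le _ _).trans (add_le_add le_rfl hbad)
  rw [ENNReal.ofReal_sub _ hζ.le, ENNReal.ofReal_one]
  exact tsub_le_iff_right.2 hone

theorem lemma6p2 :
    -- Privacy, for every dataset size and every choice of the other inputs.
    (∀ (d B : ℕ) (ε δ ζ K a Λ : ℝ), 0 < ε → ε < 0.9 → 0 < δ → δ < 1 → 0 < ζ → ζ < 1 →
      0 < K → 0 < a → 0 < Λ →
      IsDifferentiallyPrivate (n := B) (X := Fin d → ℝ) (privateMeanNoise d)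
        (privateMean ε δ ζ K a Λ) ε δ) ∧
    -- Utility; the constant `C` depends on the tail exponent `a` only.
    (∀ a : ℝ, 0 < a → ∃ C : ℝ, 0 < C ∧
      ∀ (d B : ℕ) (ε δ ζ K Λ : ℝ) (μ : Measure (Matrix (Fin d) (Fin d) ℝ))
        (S : Matrix (Fin d) (Fin d) ℝ) (u : Fin d → ℝ),
        0 < ε → ε < 0.9 → 0 < δ → δ < 1 → 0 < ζ → ζ < 1 →
        GradientModel μ S K a →
        0 < Λ →
        topEigenvalue S ^ 2 * spectralNorm₂ (Hmat μ S u) / √2 ≤ Λ →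
        Λ ≤ √2 * (topEigenvalue S ^ 2 * spectralNorm₂ (Hmat μ S u)) →
        2 ≤ B →
        δ ≤ 1 / (B : ℝ) →
        C * (√(d * Real.log (1 / δ)) / ε * Real.log (d / (ζ * δ))) ≤ (B : ℝ) →
        -- `ω.1` is an i.i.d. sample `A_1, …, A_B` from `μ`, and `ω.2` is the histogram noise.
        ENNReal.ofReal (1 - ζ) ≤
          ((Measure.pi fun _ : Fin B => μ).prod (histNoise d))
            {ω : (Fin B → Matrix (Fin d) (Fin d) ℝ) × (Fin d → ℤ → ℝ) |
              -- every gradient `g_i = A_i u` lies in the truncation box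
              (∀ i j, (ω.1 i).mulVec u j ∈ Set.Icc
                (boxCenter ε δ K a Λ (fun i => (ω.1 i).mulVec u) ω.2 j
                  - 3 * K * √Λ * Real.log (B * d / ζ) ^ a)
                (boxCenter ε δ K a Λ (fun i => (ω.1 i).mulVec u) ω.2 j
                  + 3 * K * √Λ * Real.log (B * d / ζ) ^ a)) ∧
              -- no truncation occurs
              truncated ε δ ζ K a Λ (fun i => (ω.1 i).mulVec u) ω.2 =
                (fun i => (ω.1 i).mulVec u) ∧
              -- given `ω`, the output is the empirical mean plus spherical Gaussian noise
              (stdGaussianNoise d).map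
                  (fun z => privateMean ε δ ζ K a Λ (fun i => (ω.1 i).mulVec u) (ω.2, z)) =
                sphericalGaussian (empiricalMean fun i => (ω.1 i).mulVec u)
                  (noiseScale d B ε δ ζ K a Λ)}) := by
  refine ⟨fun d B ε δ ζ K a Λ hε hε1 hδ hδ1 hζ hζ1 hK _ hΛ =>
    privateMean_isDifferentiallyPrivate d B ε δ ζ K a Λ hε hε1 hδ hδ1 hζ hζ1 hK hΛ, ?_⟩
  intro a ha
  have hexp := Real.exp_pos (Real.log 25 * 4 ^ (1 / a) + 8 * a)
  refine ⟨3600 + 2 * Real.exp (Real.log 25 * 4 ^ (1 / a) + 8 * a), by positivity, ?_⟩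
  intro d B ε δ ζ K Λ μ S u hε hε1 hδ hδ1 hζ hζ1 hM hΛ hV1 hV2 hB2 hδB hCB
  refine (privateMean_utility ha (by linarith) (by linarith) d B ε δ ζ K Λ μ S u hε hε1 hδ hδ1
    hζ hζ1 hM hΛ hV1 hV2 hB2 hδB hCB).trans (measure_mono fun ω hω => ?_)
  have htr : truncated ε δ ζ K a Λ (fun i => (ω.1 i).mulVec u) ω.2 =
      fun i => (ω.1 i).mulVec u := truncated_eq_self hω
  refine ⟨fun i j => ?_, htr, map_privateMean_eq_sphericalGaussian htr⟩
  have h := abs_le.1 (hω i j)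
  rw [truncRadius] at h
  constructor <;> linarith
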